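/- Let $p$ be a prime, let $k$ be an algebraically closed field of characteristic $p$, and let $G=\mathrm{SL}_2(\mathbb{F}_p)$, where $\mathbb{F}_p\subseteq k$ is the prime field. For $n\ge 1$ let $V_n$ be the $n$-dimensional $kG$-module of homogeneous polynomials over $k$ of degree $n-1$ in $X,Y$ with action $$\begin{pmatrix}a&b\\c&d\end{pmatrix}f(X,Y)=f(aX+cY,\;bX+dY),$$ and let $P_n$ be the projective cover of the $kG$-module $V_n$. For $n\ge m\ge 1$ put $$\langle n,m\rangle=\{n+m-1,\,n+m-3,\,\ldots,\,n-m+3,\,n-m+1\},$$ and write $[p]=\{1,\ldots,p\}$. Then for all $1\le m\le n\le p$ there is an isomorphism of $kG$-modules $$V_n\otimes V_m\;\cong\;\bigoplus_{\substack{i\in\langle n,m\rangle\cap[p]\\ 2p-i\notin\langle n,m\rangle}}V_i\;\oplus\bigoplus_{\substack{i\in\langle n,m\rangle\cap[p]\\ 2p-i\in\langle n,m\rangle}}P_i\;\oplus\;W,$$ where $W=V_p$ if $n=m=p$ and $W=0$ otherwise. Here $V_n\otimes V_m$ is the tensor product over $k$ with the diagonal $G$-action. -/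

import Mathlib

noncomputable section

namespace SL2Fp

open MvPolynomial
open scoped MonoidAlgebra

universe u

section ProjectiveCover

/-- `π : P → M` is a projective cover of the `R`-module `M`: the module `P` is projective, `π` is
surjective, and `π` is essential, i.e. its kernel is a superfluous submodule of `P`. -/
structure IsProjectiveCover {R : Type*} [Ring R] {P M : Type*} [AddCommGroup P] [Module R P]
    [AddCommMonoid M] [Module R M] (π : P →ₗ[R] M) : Prop where
  projective : Module.Projective R P
  surjective : Function.Surjective π
  essential : ∀ N : Submodule R P, N ⊔ LinearMap.ker π = ⊤ → N = ⊤

/-- Finitely generated modules over an Artinian ring have projective covers. -/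
theorem exists_isProjectiveCover (R : Type u) [Ring R] [IsArtinianRing R] (M : Type u)
    [AddCommMonoid M] [Module R M] [Module.Finite R M] :
    ∃ (P : ModuleCat.{u} R) (π : P →ₗ[R] M), IsProjectiveCover π := by
  obtain ⟨d, f, hf⟩ := Module.Finite.exists_fin' R M
  -- a minimal projective submodule of the free module that still surjects onto `M`
  let T : Set (Submodule R (Fin d → R)) :=
    {S | Module.Projective R S ∧ S.map f = ⊤}
  have hT : T.Nonempty := by
    refine ⟨⊤, ?_, ?_⟩
    · exact Module.Projective.of_equiv (Submodule.topEquiv (R := R) (M := Fin d → R)).symm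
    · rw [Submodule.map_top, LinearMap.range_eq_top.2 hf]
  obtain ⟨S, ⟨hSp, hSf⟩, hmin⟩ := IsArtinian.set_has_minimal T hT
  let π : S →ₗ[R] M := f ∘ₗ S.subtype
  have hπ : Function.Surjective π := by
    rw [← LinearMap.range_eq_top, LinearMap.range_comp, Submodule.range_subtype, hSf]
  refine ⟨ModuleCat.of R S, π, hSp, hπ, ?_⟩
  intro N hN
  change Submodule R S at N
  have hNπ : Function.Surjective (π ∘ₗ N.subtype) := by
    rw [← LinearMap.range_eq_top, LinearMap.range_comp, Submodule.range_subtype]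
    have h1 : (N ⊔ LinearMap.ker π).map π = ⊤ := by
      have h2 : N ⊔ LinearMap.ker π = ⊤ := hN
      rw [h2, Submodule.map_top, LinearMap.range_eq_top.2 hπ]
    rw [Submodule.map_sup] at h1
    have h3 : (LinearMap.ker π).map π = ⊥ := by
      rw [eq_bot_iff, Submodule.map_le_iff_le_comap]
      exact le_of_eq (Submodule.comap_bot π).symm
    rwa [h3, sup_bot_eq] at h1
  obtain ⟨g, hg⟩ := Module.projective_lifting_property (π ∘ₗ N.subtype) π hNπ
  let e : Module.End R S := N.subtype ∘ₗ g
  have he : π ∘ₗ e = π := hg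
  have hen : ∀ n, π ∘ₗ (e ^ n) = π := by
    intro n
    induction n with
    | zero => rfl
    | succ n ih =>
      rw [pow_succ, Module.End.mul_eq_comp, ← LinearMap.comp_assoc, ih, he]
  obtain ⟨n, hn, hn1⟩ :=
    (e.eventually_isCompl_ker_pow_range_pow.and (Filter.eventually_ge_atTop 1)).exists
  have hproj : Module.Projective R (LinearMap.range (e ^ n)) := by
    exact Module.Projective.of_split (LinearMap.range (e ^ n)).subtype
      ((LinearMap.range (e ^ n)).projectionOnto (LinearMap.ker (e ^ n)) hn.symm)
      (Submodule.projectionOnto_comp_subtype hn.symm)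
  have hmem : (LinearMap.range (e ^ n)).map S.subtype ∈ T := by
    refine ⟨?_, ?_⟩
    · exact Module.Projective.of_equiv
        (Submodule.equivSubtypeMap S (LinearMap.range (e ^ n)))
    · rw [← Submodule.map_comp, ← LinearMap.range_comp]
      change LinearMap.range (π ∘ₗ (e ^ n)) = ⊤
      rw [hen, LinearMap.range_eq_top.2 hπ]
  have htop : LinearMap.range (e ^ n) = ⊤ := by
    by_contra hne
    refine hmin _ hmem (lt_of_le_of_ne (Submodule.map_subtype_le _ _) ?_)
    intro heq
    apply hne
    apply Submodule.map_injective_of_injective S.injective_subtype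
    rw [heq, Submodule.map_top, Submodule.range_subtype]
  rw [eq_top_iff]
  intro x _
  obtain ⟨y, hy⟩ : x ∈ LinearMap.range (e ^ n) := htop ▸ Submodule.mem_top
  obtain ⟨m, rfl⟩ : ∃ m, n = m + 1 := ⟨n - 1, by omega⟩
  rw [pow_succ', Module.End.mul_apply] at hy
  rw [← hy]
  exact (g _).2

end ProjectiveCover

section Modules

variable (k : Type u) [Field k] (p : ℕ) [CharP k p]

/-- The group `SL₂(𝔽_p)`. -/
abbrev G (p : ℕ) : Type := Matrix.SpecialLinearGroup (Fin 2) (ZMod p)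

/-- An entry of a matrix in `SL₂(𝔽_p)`, regarded as an element of `k` through the embedding of the
prime field `𝔽_p` in `k`. -/
abbrev entry (A : G p) (i j : Fin 2) : k := ZMod.castHom (dvd_refl p) k (A.1 i j)

/-- The substitution `f(X, Y) ↦ f(aX + cY, bX + dY)` for a matrix with rows `(a, b)` and `(c, d)`;
the variables are `X = X 0` and `Y = X 1`. -/
def subst (A : G p) : MvPolynomial (Fin 2) k →ₐ[k] MvPolynomial (Fin 2) k :=
  aeval ![C (entry k p A 0 0) * X 0 + C (entry k p A 1 0) * X 1,
    C (entry k p A 0 1) * X 0 + C (entry k p A 1 1) * X 1]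

theorem subst_one : subst k p 1 = AlgHom.id k _ := by
  apply MvPolynomial.algHom_ext
  intro i
  fin_cases i <;> simp [subst, entry]

theorem subst_mul (A B : G p) : subst k p (A * B) = (subst k p A).comp (subst k p B) := by
  apply MvPolynomial.algHom_ext
  intro i
  fin_cases i <;> simp [subst, entry, Matrix.mul_apply, Fin.sum_univ_two] <;> ring

theorem subst_mem (A : G p) (d : ℕ) (f : MvPolynomial (Fin 2) k)
    (hf : f ∈ homogeneousSubmodule (Fin 2) k d) :
    subst k p A f ∈ homogeneousSubmodule (Fin 2) k d := by
  rw [mem_homogeneousSubmodule] at hf ⊢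
  have := MvPolynomial.IsHomogeneous.aeval (n := 1) (τ := Fin 2) hf ![C (entry k p A 0 0) * X 0 + C (entry k p A 1 0) * X 1,
    C (entry k p A 0 1) * X 0 + C (entry k p A 1 1) * X 1] (by
      intro i
      fin_cases i <;>
      exact ((isHomogeneous_C_mul_X _ _).add (isHomogeneous_C_mul_X _ _)))
  rw [one_mul] at this
  exact this

/-- The underlying space of `V_n`: homogeneous polynomials of degree `n - 1` in two variables.
Only the indices `n ≥ 1` are meaningful. -/
abbrev VSpace (n : ℕ) : Type u := homogeneousSubmodule (Fin 2) k (n - 1)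

instance (n : ℕ) : Module.Finite k (VSpace k n) :=
  Module.Finite.iff_fg.2 (homogeneousSubmodule_fg _ _ (n - 1))

/-- The `n`-dimensional representation `V_n` of `SL₂(𝔽_p)` over `k`. -/
def V (n : ℕ) : Representation k (G p) (VSpace k n) where
  toFun A := (subst k p A).toLinearMap.restrict (fun f hf => subst_mem k p A (n - 1) f hf)
  map_one' := by
    ext f : 2
    exact DFunLike.congr_fun (subst_one k p) f.1
  map_mul' A B := by
    ext f : 2
    exact DFunLike.congr_fun (subst_mul k p A B) f.1

variable [Fact p.Prime]

instance : Module.Finite k k[G p] :=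
  Module.Finite.equiv (MonoidAlgebra.coeffLinearEquiv k).symm

instance : IsArtinianRing k[G p] := IsArtinianRing.of_finite k _

instance (n : ℕ) : Module.Finite k[G p] (V k p n).asModule :=
  Module.Finite.of_restrictScalars_finite k _ _

theorem exists_cover (n : ℕ) :
    ∃ (P : ModuleCat.{u} k[G p]) (π : P →ₗ[k[G p]] (V k p n).asModule), IsProjectiveCover π :=
  exists_isProjectiveCover _ _

/-- A projective cover of the `k[G]`-module `V_n` (unique up to isomorphism). -/
def PModule (n : ℕ) : ModuleCat.{u} k[G p] := (exists_cover k p n).choose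

theorem PModule_spec (n : ℕ) :
    ∃ π : PModule k p n →ₗ[k[G p]] (V k p n).asModule, IsProjectiveCover π :=
  (exists_cover k p n).choose_spec

/-- The underlying space of `P_n`. -/
abbrev PSpace (n : ℕ) : Type u := RestrictScalars k k[G p] (PModule k p n)

/-- The projective cover `P_n` of `V_n`, as a representation of `SL₂(𝔽_p)` over `k`. -/
def P (n : ℕ) : Representation k (G p) (PSpace k p n) :=
  Representation.ofModule (PModule k p n)

end Modules

/-- The `(n, m)`-string `{n + m - 1, n + m - 3, …, n - m + 3, n - m + 1}`, for `n ≥ m`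
(no truncation occurs in that range; it is empty for `m = 0`). -/
def nmString (n m : ℕ) : Finset ℕ := (Finset.range m).image (fun j => n + m - 1 - 2 * j)

/-- The `i` in the `(n, m)`-string with `1 ≤ i ≤ p` such that `2p - i` is not in the string. -/
def unpaired (p n m : ℕ) : Finset ℕ :=
  {i ∈ nmString n m ∩ Finset.Icc 1 p | 2 * p - i ∉ nmString n m}

/-- The `i` in the `(n, m)`-string with `1 ≤ i ≤ p` such that `2p - i` is in the string. -/
def paired (p n m : ℕ) : Finset ℕ :=
  {i ∈ nmString n m ∩ Finset.Icc 1 p | 2 * p - i ∈ nmString n m}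

end SL2Fp

end

/-! Realise `V_n ⊗ V_m` as the forms of bidegree `(n - 1, m - 1)` in two pairs of variables. Four
operators are used there: Cayley's operator `cayley`, multiplication by the determinant `mulDet`,
and the polarizations `polarDown` and `polarUp`. The first three are shown to commute with `G`, and
the commutators of `cayley` with `mulDet` and of `polarDown` with `polarUp` are given by Euler
operators, hence are scalars on each bidegree.

Put `l = n + m - p` (truncated at `0`). The string element `i = n + m - 1 - 2r` is unpaired exactly
when `l ≤ r < m`. For these `r` the classical Clebsch–Gordan argument survives in characteristic
`p`: the transvectant of order `r` undoes the inclusion of `V_i` up to a scalar with all factors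
below `p`, and different orders are orthogonal. The rest of `V_n ⊗ V_m` is the image of `V_p ⊗ V_l`
under the `(p - n)`-th power of `polarDown`. This map is injective by an `sl_2`-string computation,
and its image is killed by the transvectants of order at least `l`, because `cayley` commutes with
`polarDown`. Since `(m - l)(n - l) + p l = n m`, this is a direct sum decomposition
(`exists_equiv_unpaired_prod`).

It remains to decompose `V_p ⊗ V_l` (`exists_equiv_paired_prod`). The Steinberg module `V_p` is the
regular module of the unitriangular group `U`, whose index `p² - 1` is `-1` in `k`, so `V_p ⊗ V_l`
is projective by Higman's criterion. It maps onto every `V_i` with `i` paired, and for `l = p` onto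
one further `V_p`; jointly these maps are surjective and lift to the projective covers.

A dimension count makes the lift an isomorphism. It needs only the lower bound `dim P_n ≥ 2p`,
weakened to `p` for `n = 1` and `n = p` (`le_finrank_PSpace`). The bound holds because a module
projective over `U` has dimension at least `p` times the rank of any `U`-invariant linear map, and
`P_n` with `1 < n < p` has two independent `U`-invariant functionals, coming from two maps to the
functions on `𝔽_p²`. -/

noncomputable section

namespace SL2Fp

open MvPolynomial
open scoped MonoidAlgebra TensorProduct

universe u

/-! ### Binary forms, dehomogenization and power sums over the prime field. -/

section BinaryForms

variable (k : Type u) [Field k]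

/-- The monomial `X ^ (d - l) * Y ^ l`. -/
def mono (d l : ℕ) : MvPolynomial (Fin 2) k := X 0 ^ (d - l) * X 1 ^ l

theorem mono_mem (d l : ℕ) (h : l ≤ d) : mono k d l ∈ homogeneousSubmodule (Fin 2) k d := by
  have := ((isHomogeneous_X k (0 : Fin 2)).pow (d - l)).mul ((isHomogeneous_X k (1 : Fin 2)).pow l)
  simp only [one_mul] at this
  rw [Nat.sub_add_cancel h] at this
  exact this

theorem homogeneousSubmodule_eq_span (d : ℕ) :
    homogeneousSubmodule (Fin 2) k d =
      Submodule.span k (Set.range fun l : Fin (d + 1) => mono k d l) := by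
  apply le_antisymm
  · intro f hf
    rw [f.as_sum]
    refine Submodule.sum_mem _ fun v hv => ?_
    have hd : v 0 + v 1 = d := by
      have := (mem_homogeneousSubmodule _ _).1 hf (mem_support_iff.1 hv)
      rw [Finsupp.weight_apply, Finsupp.sum_fintype _ _ (by simp)] at this
      simpa using this
    have : monomial v (coeff v f) = coeff v f • mono k d (v 1) := by
      rw [monomial_eq, Finsupp.prod_fintype _ _ (by simp), smul_eq_C_mul, Fin.prod_univ_two, mono]
      congr 3
      omega
    rw [this]
    exact Submodule.smul_mem _ _ (Submodule.subset_span ⟨⟨v 1, by omega⟩, rfl⟩)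
  · rw [Submodule.span_le]
    rintro _ ⟨l, rfl⟩
    exact mono_mem k d l (by omega)

variable {k}

/-- Linear maps out of the space of binary forms agree if they agree on monomials. -/
theorem eq_of_eq_mono {M : Type*} [AddCommGroup M] [Module k M] {d : ℕ}
    (F F' : MvPolynomial (Fin 2) k →ₗ[k] M) (h : ∀ l ≤ d, F (mono k d l) = F' (mono k d l))
    {f : MvPolynomial (Fin 2) k} (hf : f ∈ homogeneousSubmodule (Fin 2) k d) : F f = F' f := by
  rw [homogeneousSubmodule_eq_span] at hf
  refine LinearMap.eqOn_span (f := F) (g := F') ?_ hf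
  rintro _ ⟨l, rfl⟩
  exact h l (by omega)

theorem homogeneousSubmodule_le_of_mono {d : ℕ} {W : Submodule k (MvPolynomial (Fin 2) k)}
    (h : ∀ l ≤ d, mono k d l ∈ W) : homogeneousSubmodule (Fin 2) k d ≤ W := by
  rw [homogeneousSubmodule_eq_span, Submodule.span_le]
  rintro _ ⟨l, rfl⟩
  exact h l (by omega)

variable (k) in
/-- Dehomogenization: `X ↦ 1`, `Y ↦ T`. -/
def dehom : MvPolynomial (Fin 2) k →ₐ[k] Polynomial k := aeval ![1, Polynomial.X]

theorem dehom_mono (d l : ℕ) : dehom k (mono k d l) = Polynomial.X ^ l := by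
  simp [dehom, mono]

theorem eval_dehom (f : MvPolynomial (Fin 2) k) (y : k) :
    (dehom k f).eval y = eval ![1, y] f := by
  have : (Polynomial.aeval y).comp (dehom k) = (aeval ![1, y] : _ →ₐ[k] k) := by
    apply MvPolynomial.algHom_ext
    intro i
    fin_cases i <;> simp [dehom]
  have := DFunLike.congr_fun this f
  simpa [aeval_eq_eval, Polynomial.aeval_def, Polynomial.eval₂_eq_eval_map] using this

variable (k) in
theorem linearIndependent_mono (d : ℕ) :
    LinearIndependent k (fun l : Fin (d + 1) => mono k d l) := by
  apply LinearIndependent.of_comp (dehom k).toLinearMap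
  have : ((dehom k).toLinearMap ∘ fun l : Fin (d + 1) => mono k d l)
      = (Polynomial.basisMonomials k) ∘ (fun l : Fin (d + 1) => (l : ℕ)) := by
    ext1 l
    simp [dehom_mono, Polynomial.X_pow_eq_monomial]
  rw [this]
  exact (Polynomial.basisMonomials k).linearIndependent.comp _ Fin.val_injective

variable (k) in
theorem finrank_homogeneousSubmodule (d : ℕ) :
    Module.finrank k (homogeneousSubmodule (Fin 2) k d) = d + 1 := by
  rw [homogeneousSubmodule_eq_span, finrank_span_eq_card (linearIndependent_mono k d),
    Fintype.card_fin]

variable (k) in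
theorem finrank_VSpace {n : ℕ} (hn : 1 ≤ n) : Module.finrank k (VSpace k n) = n := by
  exact (finrank_homogeneousSubmodule k (n - 1)).trans (Nat.sub_add_cancel hn)

theorem dehom_natDegree_le {d : ℕ} {f : MvPolynomial (Fin 2) k}
    (hf : f ∈ homogeneousSubmodule (Fin 2) k d) : (dehom k f).natDegree ≤ d := by
  have h : homogeneousSubmodule (Fin 2) k d ≤
      (Polynomial.degreeLE k d).comap (dehom k).toLinearMap := by
    apply homogeneousSubmodule_le_of_mono
    intro l hl
    rw [Submodule.mem_comap, AlgHom.toLinearMap_apply, dehom_mono, Polynomial.mem_degreeLE,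
      Polynomial.degree_X_pow]
    exact_mod_cast hl
  exact Polynomial.natDegree_le_iff_degree_le.2 (Polynomial.mem_degreeLE.1 (h hf))

theorem eq_zero_of_dehom {d : ℕ} {f : MvPolynomial (Fin 2) k}
    (hf : f ∈ homogeneousSubmodule (Fin 2) k d) (h : dehom k f = 0) : f = 0 := by
  rw [homogeneousSubmodule_eq_span] at hf
  obtain ⟨c, rfl⟩ := (Submodule.mem_span_range_iff_exists_fun k).1 hf
  have hli : LinearIndependent k (fun l : Fin (d + 1) => (Polynomial.X ^ (l : ℕ) : Polynomial k)) := by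
    have := (Polynomial.basisMonomials k).linearIndependent.comp
      (fun l : Fin (d + 1) => (l : ℕ)) Fin.val_injective
    convert this using 1
    ext1 l
    simp [Polynomial.X_pow_eq_monomial]
  have hc := Fintype.linearIndependent_iff.1 hli c (by
    simpa [map_sum, map_smul, dehom_mono] using h)
  simp [hc]

section PrimeField

variable (k) (p : ℕ) [Fact p.Prime] [CharP k p]

/-- The embedding of the prime field. -/
abbrev cst : ZMod p →+* k := ZMod.castHom (dvd_refl p) k

theorem cst_injective : Function.Injective (cst k p) := (cst k p).injective

/-- The sum of `t ^ e` is `-1` for positive multiples `e` of `p - 1` and `0` otherwise; the bound on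
`e` leaves only the multiple `p - 1` itself. -/
theorem sum_cst_pow {e : ℕ} (he : e < 2 * (p - 1)) :
    ∑ t : ZMod p, cst k p t ^ e = if e = p - 1 then -1 else 0 := by
  have hp := (Fact.out : p.Prime).two_le
  have h : ∑ t : ZMod p, t ^ e = if e = p - 1 then -1 else 0 := by
    by_cases h0 : e = 0
    · subst h0
      -- For `e = 0` every term is `1`, also at `t = 0`, and the sum is `p = 0`.
      rw [if_neg (by omega)]
      simp
    · have h1 : ∑ t : ZMod p, t ^ e = ∑ t : (ZMod p)ˣ, ((t : ZMod p)) ^ e := by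
        rw [← Finset.sum_subset (Finset.subset_univ (Finset.univ.filter fun t : ZMod p => t ≠ 0))
          (by
            intro x _ hx
            have : x = 0 := by simpa using hx
            rw [this, zero_pow h0])]
        symm
        refine Finset.sum_bij (fun t _ => (t : ZMod p)) ?_ ?_ ?_ ?_
        · intro t _; simp
        · intro a _ b _ h; exact Units.ext h
        · intro b hb
          exact ⟨Units.mk0 b (by simpa using hb), by simp, rfl⟩
        · intro _ _; rfl
      rw [h1, FiniteField.sum_pow_units, ZMod.card]
      congr 1
      rw [eq_iff_iff]
      constructor
      · rintro ⟨c, rfl⟩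
        have : c < 2 := by
          by_contra hc
          have : (p - 1) * 2 ≤ (p - 1) * c := Nat.mul_le_mul_left _ (by omega)
          omega
        have : c = 1 := by
          rcases c with _ | _ | c
          · simp at h0
          · rfl
          · omega
        rw [this, mul_one]
      · rintro rfl; exact dvd_refl _
  have := congrArg (cst k p) h
  rw [map_sum] at this
  simp only [map_pow] at this
  rw [this]
  split_ifs <;> simp

/-- Extraction of a coefficient of a power of a linear polynomial by a sum over the prime field. -/
theorem sum_smul_add_smul_pow {A : Type*} [CommRing A] [Algebra k A] (a b : A) {l j : ℕ}
    (hl : l ≤ p - 1) (hj : j ≤ p - 1) (h : 1 ≤ j ∨ l < p - 1) :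
    ∑ t : ZMod p, cst k p t ^ (p - 1 - j) • (a + cst k p t • b) ^ l =
      - ((l.choose j : k) • (a ^ (l - j) * b ^ j)) := by
  have hp := (Fact.out : p.Prime).two_le
  have h1 : ∀ t : ZMod p, cst k p t ^ (p - 1 - j) • (a + cst k p t • b) ^ l =
      ∑ s ∈ Finset.range (l + 1),
        (cst k p t ^ (p - 1 - j + s)) • ((l.choose s : k) • (a ^ (l - s) * b ^ s)) := by
    intro t
    rw [add_comm a, add_pow, Finset.smul_sum]
    refine Finset.sum_congr rfl fun s _ => ?_
    simp only [Algebra.smul_def, mul_pow, map_pow, pow_add, map_natCast, map_mul]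
    ring
  simp_rw [h1]
  rw [Finset.sum_comm]
  simp_rw [← Finset.sum_smul]
  -- Only the exponent `p - 1` survives, which means `s = j`. The hypothesis `h` excludes the
  -- exponent `2 * (p - 1)`, which would occur for `j = 0` and `s = l = p - 1`.
  by_cases hjl : j ≤ l
  · rw [Finset.sum_eq_single j]
    · rw [sum_cst_pow k p (by omega), if_pos (by omega), neg_one_smul]
    · intro s hs hsj
      rw [Finset.mem_range] at hs
      rw [sum_cst_pow k p (by omega), if_neg (by omega), zero_smul]
    · intro hj'
      rw [Finset.mem_range] at hj'
      omega
  · rw [Nat.choose_eq_zero_of_lt (by omega), Nat.cast_zero, zero_smul, neg_zero]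
    refine Finset.sum_eq_zero fun s hs => ?_
    rw [Finset.mem_range] at hs
    rw [sum_cst_pow k p (by omega), if_neg (by omega), zero_smul]

omit [Fact p.Prime] in
theorem natCast_ne_zero_of_lt {a : ℕ} (h0 : 0 < a) (h : a < p) : (a : k) ≠ 0 := by
  rw [Ne, CharP.cast_eq_zero_iff k p]
  exact fun hd => absurd (Nat.le_of_dvd h0 hd) (by omega)

theorem factorial_ne_zero_of_lt {a : ℕ} (h : a < p) : (a.factorial : k) ≠ 0 := by
  rw [Ne, CharP.cast_eq_zero_iff k p, (Fact.out : p.Prime).dvd_factorial]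
  omega

theorem choose_ne_zero_of_lt {a b : ℕ} (hb : b ≤ a) (h : a < p) : (a.choose b : k) ≠ 0 := by
  intro h0
  have := congrArg (Nat.cast (R := k)) (Nat.choose_mul_factorial_mul_factorial hb)
  push_cast at this
  rw [h0, zero_mul, zero_mul] at this
  exact factorial_ne_zero_of_lt k p h this.symm

variable {k p}

/-- A form of degree less than `p` which vanishes at all points `(1, y)` over `𝔽_p` is zero. -/
theorem eq_zero_of_eval_eq_zero {d : ℕ} (hd : d < p) {f : MvPolynomial (Fin 2) k}
    (hf : f ∈ homogeneousSubmodule (Fin 2) k d)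
    (h : ∀ y : ZMod p, eval ![1, cst k p y] f = 0) : f = 0 := by
  apply eq_zero_of_dehom hf
  apply Polynomial.eq_zero_of_natDegree_lt_card_of_eval_eq_zero _ (cst_injective k p)
  · intro y
    rw [eval_dehom, h]
  · rw [ZMod.card]
    exact (dehom_natDegree_le hf).trans_lt hd

end PrimeField

end BinaryForms

/-! ### Simplicity of `V_n` for `n ≤ p`. -/

section Simplicity

variable {k : Type u} [Field k] {p : ℕ} [CharP k p]

theorem V_apply_coe (n : ℕ) (A : G p) (f : VSpace k n) : (V k p n A f : MvPolynomial (Fin 2) k) = subst k p A f := rfl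

/-- Substitution moves the point of evaluation. -/
theorem eval_subst (A : G p) (f : MvPolynomial (Fin 2) k) (v : Fin 2 → k) :
    eval v (subst k p A f) = eval (Matrix.vecMul v (A.1.map (ZMod.castHom (dvd_refl p) k))) f := by
  have : (aeval v : _ →ₐ[k] k).comp (subst k p A) =
      aeval (Matrix.vecMul v (A.1.map (ZMod.castHom (dvd_refl p) k))) := by
    apply MvPolynomial.algHom_ext
    intro i
    fin_cases i <;> simp [subst, entry, Matrix.vecMul, dotProduct, Fin.sum_univ_two, mul_comm]
  have := DFunLike.congr_fun this f
  simpa [aeval_eq_eval] using this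

/-- The upper unitriangular matrices. -/
def upper (t : ZMod p) : G p := ⟨!![1, t; 0, 1], by simp [Matrix.det_fin_two]⟩

theorem upper_add (s t : ZMod p) : upper (p := p) (s + t) = upper s * upper t := by
  apply Subtype.ext
  rw [Matrix.SpecialLinearGroup.coe_mul]
  ext i j
  fin_cases i <;> fin_cases j <;> simp [upper, add_comm]

theorem upper_zero : upper (p := p) 0 = 1 := by
  ext i j
  fin_cases i <;> fin_cases j <;> simp [upper]

theorem upper_neg (t : ZMod p) : upper (p := p) (-t) = (upper t)⁻¹ := by
  rw [eq_inv_iff_mul_eq_one, ← upper_add, neg_add_cancel, upper_zero]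

/-- The lower unitriangular matrices. -/
def lower (t : ZMod p) : G p := ⟨!![1, 0; t, 1], by simp [Matrix.det_fin_two]⟩

variable [Fact p.Prime]

theorem subst_upper_mono (t : ZMod p) (d l : ℕ) :
    subst k p (upper t) (mono k d l) = X 0 ^ (d - l) * (X 1 + cst k p t • X 0) ^ l := by
  simp [subst, mono, upper, entry, smul_eq_C_mul, add_comm]

theorem subst_lower_X_pow (t : ZMod p) (d : ℕ) :
    subst k p (lower t) (X 0 ^ d) = (X 0 + cst k p t • X 1) ^ d := by
  simp [subst, lower, entry, smul_eq_C_mul]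

/-- Averaging over the upper unitriangular group extracts the value at `(0, 1)`. -/
theorem sum_upper {d : ℕ} (hd : d ≤ p - 1) {f : MvPolynomial (Fin 2) k}
    (hf : f ∈ homogeneousSubmodule (Fin 2) k d) :
    ∑ t : ZMod p, cst k p t ^ (p - 1 - d) • subst k p (upper t) f =
      - (eval ![0, 1] f • X 0 ^ d) := by
  have hp := (Fact.out : p.Prime).two_le
  let F : MvPolynomial (Fin 2) k →ₗ[k] MvPolynomial (Fin 2) k :=
    ∑ t : ZMod p, cst k p t ^ (p - 1 - d) • (subst k p (upper t)).toLinearMap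
  let F' : MvPolynomial (Fin 2) k →ₗ[k] MvPolynomial (Fin 2) k :=
    -((aeval ![(0 : k), 1] : _ →ₐ[k] k).toLinearMap.smulRight (X 0 ^ d))
  have := eq_of_eq_mono F F' (d := d) ?_ hf
  · simpa [F, F', LinearMap.sum_apply, aeval_eq_eval] using this
  · intro l hl
    simp only [F, F', LinearMap.sum_apply, LinearMap.smul_apply, AlgHom.toLinearMap_apply,
      subst_upper_mono, LinearMap.neg_apply, LinearMap.smulRight_apply, ← mul_smul_comm]
    rw [← Finset.mul_sum, sum_smul_add_smul_pow k p _ _ (by omega) hd (by omega)]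
    rcases hl.lt_or_eq with hl | rfl
    · rw [Nat.choose_eq_zero_of_lt hl]
      simp [mono, Nat.sub_ne_zero_of_lt hl]
    · simp [mono]

/-- Companion of `sum_upper`: the lower unitriangular group recovers the other monomials from `X ^
d`, since the binomial coefficients are nonzero for `d < p`. -/
theorem sum_lower {d j : ℕ} (hd : d ≤ p - 1) (h1 : 1 ≤ j) (hj : j ≤ d) :
    ∑ t : ZMod p, cst k p t ^ (p - 1 - j) • subst k p (lower t) (X 0 ^ d) =
      - ((d.choose j : k) • mono k d j) := by
  simp_rw [subst_lower_X_pow]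
  rw [sum_smul_add_smul_pow k p _ _ hd (by omega) (Or.inl h1), mono]

theorem exists_vecMul_eq (v : Fin 2 → ZMod p) (hv : v ≠ 0) :
    ∃ A : G p, Matrix.vecMul ![0, 1] A.1 = v := by
  by_cases h1 : v 1 = 0
  · have h0 : v 0 ≠ 0 := fun h0 => hv (by ext i; fin_cases i <;> simp [h0, h1])
    refine ⟨⟨!![0, -(v 0)⁻¹; v 0, 0], by simp [Matrix.det_fin_two, h0]⟩, ?_⟩
    ext i
    fin_cases i <;> simp [h1]
  · refine ⟨⟨!![(v 1)⁻¹, 0; v 0, v 1], by simp [Matrix.det_fin_two, h1]⟩, ?_⟩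
    ext i
    fin_cases i <;> simp

theorem vecMul_cst (v : Fin 2 → ZMod p) (A : G p) :
    Matrix.vecMul (fun i => cst k p (v i)) (A.1.map (ZMod.castHom (dvd_refl p) k)) =
      fun i => cst k p (Matrix.vecMul v A.1 i) := by
  ext i
  simp [Matrix.vecMul, dotProduct]

/-- The modules `V_n` with `n ≤ p` are simple. -/
theorem V_simple {n : ℕ} (hn : n ≤ p) (W : Submodule k (VSpace k n))
    (hW : ∀ (A : G p), ∀ f ∈ W, V k p n A f ∈ W) (h0 : W ≠ ⊥) : W = ⊤ := by
  have hp := (Fact.out : p.Prime).two_le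
  set d := n - 1 with hd
  let W' := W.map (homogeneousSubmodule (Fin 2) k d).subtype
  have hW' : ∀ (A : G p), ∀ f ∈ W', subst k p A f ∈ W' := by
    rintro A _ ⟨f, hf, rfl⟩
    exact ⟨V k p n A f, hW A f hf, rfl⟩
  have hWd : W' ≤ homogeneousSubmodule (Fin 2) k d := Submodule.map_subtype_le _ _
  suffices h : homogeneousSubmodule (Fin 2) k d ≤ W' by
    rw [eq_top_iff]
    rintro f -
    obtain ⟨g, hg, hgf⟩ := h f.2
    rwa [← Subtype.ext hgf]
  obtain ⟨⟨f, hfd⟩, hf, hf0⟩ := Submodule.exists_mem_ne_zero_of_ne_bot h0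
  have hfW : f ∈ W' := ⟨⟨f, hfd⟩, hf, rfl⟩
  have hfne : f ≠ 0 := fun h => hf0 (Subtype.ext h)
  obtain ⟨y, hy⟩ : ∃ y : ZMod p, eval ![1, cst k p y] f ≠ 0 := by
    by_contra! h
    exact hfne (eq_zero_of_eval_eq_zero (p := p) (by omega) hfd h)
  -- Moving `(0, 1)` to a point where `f` does not vanish makes the coefficient extracted by
  -- `sum_upper` nonzero, which puts `X ^ d` in the submodule.
  obtain ⟨A, hA⟩ := exists_vecMul_eq ![1, y] (by simp)
  have hgW := hW' A f hfW
  have hg1 : eval ![0, 1] (subst k p A f) ≠ 0 := by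
    have h1 : (![0, 1] : Fin 2 → k) = fun i => cst k p ((![0, 1] : Fin 2 → ZMod p) i) := by
      ext i; fin_cases i <;> simp
    rw [eval_subst, h1, vecMul_cst, hA]
    convert hy using 3
    ext i; fin_cases i <;> simp
  have hX : X 0 ^ d ∈ W' := by
    have h1 := sum_upper (p := p) (d := d) (by omega) (hWd hgW)
    have h2 : eval ![0, 1] (subst k p A f) • (X 0 : MvPolynomial (Fin 2) k) ^ d ∈ W' := by
      rw [← neg_mem_iff, ← h1]
      exact Submodule.sum_mem _ fun t _ => Submodule.smul_mem _ _ (hW' _ _ hgW)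
    exact (Submodule.smul_mem_iff _ hg1).1 h2
  apply homogeneousSubmodule_le_of_mono
  intro j hj
  rcases Nat.eq_zero_or_pos j with rfl | hj0
  · simpa [mono] using hX
  · have h2 : (d.choose j : k) • mono k d j ∈ W' := by
      rw [← neg_mem_iff, ← sum_lower (p := p) (by omega) hj0 hj]
      exact Submodule.sum_mem _ fun t _ => Submodule.smul_mem _ _ (hW' _ _ hX)
    exact (Submodule.smul_mem_iff _ (choose_ne_zero_of_lt k p hj (by omega))).1 h2

end Simplicity

/-! ### Higman's criterion and the order of `SL₂(𝔽_p)`. -/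

section Higman

/-- Higman's criterion: a representation of a finite group whose identity is a trace is
projective. -/
theorem projective_of_trace {k G M : Type*} [Field k] [Group G] [Fintype G] [AddCommGroup M]
    [Module k M] (ρ : Representation k G M) (φ : Module.End k M)
    (h : ∑ g : G, ρ g ∘ₗ φ ∘ₗ ρ g⁻¹ = LinearMap.id) : Module.Projective k[G] ρ.asModule := by
  apply Module.Projective.of_lifting_property''
  intro f hf
  obtain ⟨s, hs⟩ := LinearMap.exists_rightInverse_of_surjective (f.restrictScalars k)
    (LinearMap.range_eq_top.2 hf)
  let t : M →ₗ[k] (ρ.asModule →₀ k[G]) := s ∘ₗ ρ.asModuleEquiv.symm.toLinearMap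
  have ht : ∀ m, f (t m) = ρ.asModuleEquiv.symm m := fun m => DFunLike.congr_fun hs _
  let L (g : G) : Module.End k (ρ.asModule →₀ k[G]) :=
    Algebra.lsmul k k (ρ.asModule →₀ k[G]) (MonoidAlgebra.single g 1 : k[G])
  have hL : ∀ g y, L g y = (MonoidAlgebra.single g 1 : k[G]) • y := fun _ _ => rfl
  -- `t` is a `k`-linear section of `f`. Averaging `t ∘ φ` over the group makes it equivariant, and
  -- it is still a section because the trace of `φ` is the identity.
  let F : ρ.asModule →ₗ[k] (ρ.asModule →₀ k[G]) :=
    (∑ g : G, L g ∘ₗ t ∘ₗ φ ∘ₗ ρ g⁻¹) ∘ₗ ρ.asModuleEquiv.toLinearMap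
  have hF : ∀ x, F x = ∑ g : G, L g (t (φ (ρ g⁻¹ (ρ.asModuleEquiv x)))) := by
    intro x
    simp [F]
  have hsm : ∀ (g : G) (x : ρ.asModule), ρ.asModuleEquiv ((MonoidAlgebra.single g 1 : k[G]) • x) =
      ρ g (ρ.asModuleEquiv x) := by
    intro g x
    rw [Representation.asModuleEquiv_map_smul, Representation.asAlgebraHom_single_one]
  refine ⟨MonoidAlgebra.equivariantOfLinearOfComm F ?_, ?_⟩
  · intro g x
    rw [hF, hF, hsm, Finset.smul_sum]
    refine (Equiv.sum_comp (Equiv.mulLeft g) _).symm.trans ?_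
    refine Finset.sum_congr rfl fun a _ => ?_
    rw [Equiv.coe_mulLeft, hL, hL, smul_smul, MonoidAlgebra.single_mul_single, one_mul,
      ← Module.End.mul_apply (ρ _) (ρ g), ← map_mul]
    congr 5
    group
  · ext x
    change f (F x) = x
    rw [hF, map_sum]
    apply ρ.asModuleEquiv.injective
    rw [map_sum]
    have h2 := DFunLike.congr_fun h (ρ.asModuleEquiv x)
    rw [LinearMap.sum_apply] at h2
    simp only [LinearMap.id_apply] at h2
    refine Eq.trans ?_ h2
    refine Finset.sum_congr rfl fun g _ => ?_
    rw [hL, map_smul, hsm, ht, LinearEquiv.apply_symm_apply]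
    rfl

end Higman

section Card

variable (p : ℕ) [Fact p.Prime]

/-- `SL₂` is the kernel of the surjective determinant on `GL₂`, whose order is known. -/
theorem card_G : Nat.card (G p) * (p - 1) = (p ^ 2 - 1) * (p ^ 2 - p) := by
  have h1 := Matrix.card_GL_field (𝔽 := ZMod p) 2
  rw [ZMod.card, Fin.prod_univ_two] at h1
  simp only [Fin.val_zero, pow_zero, Fin.val_one, pow_one] at h1
  rw [← h1]
  let det : Matrix.GeneralLinearGroup (Fin 2) (ZMod p) →* (ZMod p)ˣ := Matrix.GeneralLinearGroup.det
  rw [← Subgroup.card_mul_index det.ker, Subgroup.index_ker,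
    MonoidHom.range_eq_top.2 Matrix.GeneralLinearGroup.det_surjective]
  have h2 : (Matrix.SpecialLinearGroup.toGL : G p →* _).range = det.ker := by
    apply SetLike.coe_injective
    ext x
    constructor
    · rintro ⟨y, rfl⟩
      apply Units.ext
      simp [det]
    · intro hx
      have : (x.1).det = 1 := by simpa [det] using congrArg Units.val (show det x = 1 from hx)
      exact ⟨⟨x.1, this⟩, Units.ext rfl⟩
  rw [← h2, Nat.card_congr (MonoidHom.ofInjective
    (Matrix.SpecialLinearGroup.toGL_injective (n := Fin 2) (R := ZMod p))).symm.toEquiv]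
  congr 1
  rw [Nat.card_congr Subgroup.topEquiv.toEquiv, Nat.card_eq_fintype_card, ZMod.card_units]

variable {p}

/-- The upper unitriangular matrices, as a homomorphism. -/
def upperHom : Multiplicative (ZMod p) →* G p where
  toFun t := upper t.toAdd
  map_one' := upper_zero
  map_mul' s t := upper_add s.toAdd t.toAdd

omit [Fact p.Prime] in
theorem upper_injective : Function.Injective (upper (p := p)) := by
  intro s t h
  have := congrArg (fun A : G p => A.1 0 1) h
  simpa [upper] using this

theorem card_quotient_upper : Nat.card (G p ⧸ (upperHom (p := p)).range) = p ^ 2 - 1 := by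
  have hp := (Fact.out : p.Prime).two_le
  have h1 := (upperHom (p := p)).range.card_mul_index
  have h2 : Nat.card (upperHom (p := p)).range = p := by
    rw [Nat.card_congr (MonoidHom.ofInjective (f := upperHom (p := p)) (fun s t h =>
      upper_injective h)).symm.toEquiv]
    simp
  have h3 := card_G p
  rw [← h1, h2] at h3
  change (upperHom (p := p)).range.index = _
  have h4 : p ^ 2 - p = p * (p - 1) := by rw [Nat.mul_sub, sq, mul_one]
  rw [h4] at h3
  have : 0 < p * (p - 1) := Nat.mul_pos (by omega) (by omega)
  apply Nat.eq_of_mul_eq_mul_right this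
  rw [← h3]
  ring

end Card

/-! ### Traces over the unitriangular group and the Steinberg module. -/

section Trace

variable {k : Type u} [Field k] {p : ℕ} [Fact p.Prime] {M : Type*} [AddCommMonoid M] [Module k M]

/-- The identity of `ρ` is the trace of `φ` over the upper unitriangular group. -/
def IsUpperTrace (ρ : Representation k (G p) M) (φ : Module.End k M) : Prop :=
  ∀ x, ∑ t : ZMod p, ρ (upper t) (φ (ρ (upper (-t)) x)) = x

/-- Summing over `G` coset by coset, each coset of the unitriangular group contributes the identity
for `φ`. There are `p² - 1` cosets, which is `-1` in `k`; hence the sign. -/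
theorem IsUpperTrace.sum_eq [CharP k p] {M : Type*} [AddCommGroup M] [Module k M]
    {ρ : Representation k (G p) M} {φ : Module.End k M}
    (h : IsUpperTrace ρ φ) : ∑ g : G p, ρ g ∘ₗ (-φ) ∘ₗ ρ g⁻¹ = LinearMap.id := by
  classical
  have hp := (Fact.out : p.Prime).two_le
  ext x
  rw [LinearMap.sum_apply]
  let U := (upperHom (p := p)).range
  let E : (G p ⧸ U) × ZMod p ≃ G p := Equiv.ofBijective (fun q => q.1.out * upper q.2) (by
    constructor
    · rintro ⟨q, s⟩ ⟨r, t⟩ h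
      have hqr : q = r := by
        have := congrArg (QuotientGroup.mk (s := U)) h
        simpa only [QuotientGroup.mk_mul_of_mem _ (show upper s ∈ U from ⟨Multiplicative.ofAdd s, rfl⟩),
          QuotientGroup.mk_mul_of_mem _ (show upper t ∈ U from ⟨Multiplicative.ofAdd t, rfl⟩),
          QuotientGroup.out_eq'] using this
      subst hqr
      exact Prod.ext rfl (upper_injective (mul_left_cancel h))
    · intro g
      have : (QuotientGroup.mk (s := U) g).out⁻¹ * g ∈ U := by
        rw [← QuotientGroup.eq, QuotientGroup.out_eq']
      obtain ⟨t, ht⟩ := this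
      refine ⟨(QuotientGroup.mk g, t.toAdd), ?_⟩
      change _ * upperHom t = g
      rw [ht, mul_inv_cancel_left])
  have hE : ∀ q t, E (q, t) = q.out * upper t := fun q t => rfl
  rw [← E.sum_comp, Fintype.sum_prod_type]
  have h1 : ∀ q, ∑ t, (ρ (E (q, t)) ∘ₗ (-φ) ∘ₗ ρ (E (q, t))⁻¹) x = -x := by
    intro q
    simp_rw [hE, mul_inv_rev, ← upper_neg, map_mul]
    simp only [LinearMap.comp_apply, Module.End.mul_apply, LinearMap.neg_apply, map_neg,
      Finset.sum_neg_distrib]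
    rw [← map_sum, h, ← Module.End.mul_apply, ← map_mul, mul_inv_cancel, map_one,
      Module.End.one_apply]
  simp_rw [h1]
  rw [Finset.sum_const, Finset.card_univ, ← Nat.card_eq_fintype_card, card_quotient_upper,
    ← Nat.cast_smul_eq_nsmul k, Nat.cast_sub (Nat.one_le_pow _ _ (by omega))]
  simp

theorem IsUpperTrace.projective [CharP k p] {ρ : Representation k (G p) M} {φ : Module.End k M}
    (h : IsUpperTrace ρ φ) : Module.Projective k[G p] ρ.asModule :=
  let _ : AddCommGroup M := Module.addCommMonoidToAddCommGroup k
  projective_of_trace ρ _ h.sum_eq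

end Trace

section Steinberg

variable {k : Type u} [Field k] {p : ℕ} [Fact p.Prime] [CharP k p]

variable (k p) in
/-- The form `X ^ (p - 1) - Y ^ (p - 1)`. -/
def deltaForm : VSpace k p :=
  ⟨X 0 ^ (p - 1) - X 1 ^ (p - 1), sub_mem (by simpa using (isHomogeneous_X k (0 : Fin 2)).pow (p - 1))
    (by simpa using (isHomogeneous_X k (1 : Fin 2)).pow (p - 1))⟩

variable (k p) in
/-- Multiplication by the delta function at `0` on the Steinberg module. -/
def steinbergTrace : Module.End k (VSpace k p) :=
  ((aeval ![(1 : k), 0] : _ →ₐ[k] k).toLinearMap ∘ₗ Submodule.subtype _).smulRight (deltaForm k p)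

-- Restriction to the line `(1, y)` identifies `V_p` with the functions on `𝔽_p`, on which the
-- unitriangular group acts by translations. `X ^ (p - 1) - Y ^ (p - 1)` becomes the delta function
-- at `0`, and a function is the sum of its values times translated delta functions.
variable (k p) in
theorem isUpperTrace_steinberg : IsUpperTrace (V k p p) (steinbergTrace k p) := by
  have hp := (Fact.out : p.Prime).two_le
  intro f
  rw [← sub_eq_zero]
  apply Subtype.ext
  apply eq_zero_of_eval_eq_zero (p := p) (d := p - 1) (by omega) (Subtype.mem _)
  intro y
  have hv (t : ZMod p) : (aeval ![(1 : k), 0] : _ →ₐ[k] k) (subst k p (upper (-t)) f.1) =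
      eval ![1, cst k p (-t)] f.1 := by
    change eval _ _ = _
    rw [eval_subst]
    congr 2
    ext i; fin_cases i <;> simp [upper, Matrix.vecMul, dotProduct, Fin.sum_univ_two]
  have hd (t : ZMod p) : eval ![1, cst k p y] (subst k p (upper t) (deltaForm k p).1) =
      if t = -y then 1 else 0 := by
    rw [eval_subst]
    have : eval (Matrix.vecMul ![1, cst k p y] ((upper t).1.map (ZMod.castHom (dvd_refl p) k)))
        (deltaForm k p).1 = cst k p (1 - (t + y) ^ (p - 1)) := by
      simp [deltaForm, upper, Matrix.vecMul, dotProduct, Fin.sum_univ_two]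
    rw [this]
    split_ifs with h
    · rw [h, neg_add_cancel, zero_pow (by omega)]
      simp
    · rw [ZMod.pow_card_sub_one_eq_one (by rwa [Ne, ← eq_neg_iff_add_eq_zero])]
      simp
  have : (∑ t : ZMod p, eval ![1, cst k p (-t)] f.1 *
      eval ![1, cst k p y] (subst k p (upper t) (deltaForm k p).1)) = eval ![1, cst k p y] f.1 := by
    simp_rw [hd]
    simp
  rw [Submodule.coe_sub, map_sub, ← this, sub_eq_zero]
  simp only [AddSubmonoidClass.coe_finsetSum, map_sum]
  refine Finset.sum_congr rfl fun t _ => ?_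
  rw [← hv]
  simp only [V_apply_coe, steinbergTrace, LinearMap.smulRight_apply, map_smul, Submodule.coe_smul,
    smul_eval, LinearMap.comp_apply, Submodule.subtype_apply, AlgHom.toLinearMap_apply]

omit [CharP k p] in
theorem IsUpperTrace.tprod {M N : Type*} [AddCommMonoid M] [Module k M] [AddCommMonoid N] [Module k N]
    {ρ : Representation k (G p) M} {φ : Module.End k M} (h : IsUpperTrace ρ φ)
    (σ : Representation k (G p) N) : IsUpperTrace (ρ.tprod σ) (φ.rTensor N) := by
  intro x
  induction x with
  | zero => simp
  | add x y hx hy => simp only [map_add, Finset.sum_add_distrib, hx, hy]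
  | tmul x y =>
    simp only [Representation.tprod_apply, TensorProduct.map_tmul, LinearMap.rTensor_tmul]
    simp only [← Module.End.mul_apply, ← map_mul, ← upper_add, add_neg_cancel, upper_zero]
    simp only [Module.End.mul_apply, map_one, Module.End.one_apply]
    rw [← TensorProduct.sum_tmul, h]

variable (k p) in
theorem projective_steinberg_tprod (m : ℕ) :
    Module.Projective k[G p] ((V k p p).tprod (V k p m)).asModule := by
  exact ((isUpperTrace_steinberg k p).tprod (V k p m)).projective

end Steinberg

/-! ### Polarization, Cayley's operator and their commutation relations. -/

section Operators

variable (k : Type u) [Field k]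

/-- The algebra of polynomials in two pairs of variables. -/
abbrev Bipoly : Type u := MvPolynomial (Fin 2) k ⊗[k] MvPolynomial (Fin 2) k

/-- Partial differentiation. -/
def dX (i : Fin 2) : Module.End k (MvPolynomial (Fin 2) k) := (pderiv i).toLinearMap

/-- Multiplication by a variable. -/
def mX (i : Fin 2) : Module.End k (MvPolynomial (Fin 2) k) := LinearMap.mulLeft k (X i)

/-- The polarization operator lowering the first degree. -/
def polarDown : Module.End k (Bipoly k) :=
  TensorProduct.map (dX k 0) (mX k 0) + TensorProduct.map (dX k 1) (mX k 1)

/-- The polarization operator raising the first degree. -/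
def polarUp : Module.End k (Bipoly k) :=
  TensorProduct.map (mX k 0) (dX k 0) + TensorProduct.map (mX k 1) (dX k 1)

/-- Cayley's operator. -/
def cayley : Module.End k (Bipoly k) :=
  TensorProduct.map (dX k 0) (dX k 1) - TensorProduct.map (dX k 1) (dX k 0)

/-- Multiplication by the determinant of the two pairs of variables. -/
def mulDet : Module.End k (Bipoly k) :=
  TensorProduct.map (mX k 0) (mX k 1) - TensorProduct.map (mX k 1) (mX k 0)

/-- The Euler operator. -/
def euler : Module.End k (MvPolynomial (Fin 2) k) := mX k 0 * dX k 0 + mX k 1 * dX k 1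

variable {k}

theorem dX_mX_self (i : Fin 2) (f : MvPolynomial (Fin 2) k) :
    dX k i (mX k i f) = f + mX k i (dX k i f) := by
  simp [dX, mX, add_comm]

theorem dX_mX_of_ne {i j : Fin 2} (h : i ≠ j) (f : MvPolynomial (Fin 2) k) :
    dX k i (mX k j f) = mX k j (dX k i f) := by
  simp [dX, mX, pderiv_X_of_ne h.symm]

theorem dX_comm (f : MvPolynomial (Fin 2) k) : dX k 1 (dX k 0 f) = dX k 0 (dX k 1 f) := by
  have h : ⁅pderiv (R := k) (1 : Fin 2), pderiv (R := k) (0 : Fin 2)⁆ = 0 := by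
    apply MvPolynomial.derivation_ext
    intro i
    fin_cases i <;> simp [Derivation.commutator_apply, pderiv_X]
  have := DFunLike.congr_fun h f
  rw [Derivation.commutator_apply] at this
  exact sub_eq_zero.1 this

theorem cayley_mulDet (v : Bipoly k) : cayley k (mulDet k v) = mulDet k (cayley k v) +
    ((euler k).rTensor _ v + (euler k).lTensor _ v + (2 : k) • v) := by
  induction v using TensorProduct.induction_on with
  | zero => simp
  | add x y hx hy => simp only [map_add, hx, hy, smul_add]; abel
  | tmul f g =>
    simp only [cayley, mulDet, euler, LinearMap.sub_apply, LinearMap.add_apply,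
      TensorProduct.map_tmul, map_sub, Module.End.mul_apply, LinearMap.rTensor_tmul,
      LinearMap.lTensor_tmul, dX_mX_self, dX_mX_of_ne zero_ne_one, dX_mX_of_ne one_ne_zero,
      TensorProduct.add_tmul, TensorProduct.tmul_add, two_smul]
    abel

theorem polarDown_polarUp (v : Bipoly k) : polarDown k (polarUp k v) = polarUp k (polarDown k v) +
    ((euler k).lTensor _ v - (euler k).rTensor _ v) := by
  induction v using TensorProduct.induction_on with
  | zero => simp
  | add x y hx hy => simp only [map_add, hx, hy]; abel
  | tmul f g =>
    simp only [polarDown, polarUp, euler, LinearMap.add_apply,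
      TensorProduct.map_tmul, map_add, Module.End.mul_apply, LinearMap.rTensor_tmul,
      LinearMap.lTensor_tmul, dX_mX_self, dX_mX_of_ne zero_ne_one, dX_mX_of_ne one_ne_zero,
      TensorProduct.add_tmul, TensorProduct.tmul_add]
    abel

theorem cayley_polarDown (v : Bipoly k) :
    cayley k (polarDown k v) = polarDown k (cayley k v) := by
  induction v using TensorProduct.induction_on with
  | zero => simp
  | add x y hx hy => simp only [map_add, hx, hy]
  | tmul f g =>
    simp only [polarDown, cayley, LinearMap.add_apply, LinearMap.sub_apply,
      TensorProduct.map_tmul, map_add, map_sub, dX_mX_self, dX_mX_of_ne zero_ne_one,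
      dX_mX_of_ne one_ne_zero, dX_comm, TensorProduct.tmul_add]
    abel

theorem commute_cayley_polarDown : Commute (cayley k) (polarDown k) :=
  LinearMap.ext cayley_polarDown

/-- Multiplication restricts to the diagonal, where the determinant vanishes. -/
theorem mul'_mulDet (v : Bipoly k) : LinearMap.mul' k _ (mulDet k v) = 0 := by
  induction v using TensorProduct.induction_on with
  | zero => simp
  | add x y hx hy => simp only [map_add, hx, hy, add_zero]
  | tmul f g =>
    simp only [mulDet, LinearMap.sub_apply, TensorProduct.map_tmul, map_sub, LinearMap.mul'_apply,
      mX, LinearMap.mulLeft_apply]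
    ring

theorem mul'_polarDown (v : Bipoly k) :
    LinearMap.mul' k _ (polarDown k v) = LinearMap.mul' k _ ((euler k).rTensor _ v) := by
  induction v using TensorProduct.induction_on with
  | zero => simp
  | add x y hx hy => simp only [map_add, hx, hy]
  | tmul f g =>
    simp only [polarDown, euler, LinearMap.add_apply, TensorProduct.map_tmul, map_add,
      LinearMap.mul'_apply, mX, LinearMap.mulLeft_apply, LinearMap.rTensor_tmul,
      Module.End.mul_apply]
    ring

section Bidegree

variable (k) in
/-- The forms of bidegree `(a, b)`. -/
def bidegree (a b : ℕ) : Submodule k (Bipoly k) :=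
  Submodule.map₂ (TensorProduct.mk k _ _) (homogeneousSubmodule (Fin 2) k a)
    (homogeneousSubmodule (Fin 2) k b)

theorem tmul_mem_bidegree {a b : ℕ} {f g : MvPolynomial (Fin 2) k}
    (hf : f ∈ homogeneousSubmodule (Fin 2) k a) (hg : g ∈ homogeneousSubmodule (Fin 2) k b) :
    f ⊗ₜ g ∈ bidegree k a b := Submodule.apply_mem_map₂ _ hf hg

theorem map_mem_of_bidegree {M : Type*} [AddCommGroup M] [Module k M] {a b : ℕ}
    (F : Bipoly k →ₗ[k] M) (W : Submodule k M)
    (h : ∀ f ∈ homogeneousSubmodule (Fin 2) k a, ∀ g ∈ homogeneousSubmodule (Fin 2) k b,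
      F (f ⊗ₜ g) ∈ W) {v : Bipoly k} (hv : v ∈ bidegree k a b) : F v ∈ W := by
  have : bidegree k a b ≤ W.comap F := Submodule.map₂_le.2 h
  exact this hv

theorem mX_mem {a : ℕ} {f : MvPolynomial (Fin 2) k} (i : Fin 2)
    (hf : f ∈ homogeneousSubmodule (Fin 2) k a) : mX k i f ∈ homogeneousSubmodule (Fin 2) k (a + 1) := by
  rw [add_comm]
  exact (isHomogeneous_X k i).mul hf

theorem dX_mem {a : ℕ} {f : MvPolynomial (Fin 2) k} (i : Fin 2)
    (hf : f ∈ homogeneousSubmodule (Fin 2) k (a + 1)) : dX k i f ∈ homogeneousSubmodule (Fin 2) k a :=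
  IsHomogeneous.pderiv hf

theorem dX_eq_zero {f : MvPolynomial (Fin 2) k} (i : Fin 2)
    (hf : f ∈ homogeneousSubmodule (Fin 2) k 0) : dX k i f = 0 := by
  have := totalDegree_eq_zero_iff_eq_C.1 (Nat.le_zero.1 (IsHomogeneous.totalDegree_le hf))
  rw [this]
  simp [dX]

theorem euler_apply {a : ℕ} {f : MvPolynomial (Fin 2) k}
    (hf : f ∈ homogeneousSubmodule (Fin 2) k a) : euler k f = (a : k) • f := by
  have := IsHomogeneous.sum_X_mul_pderiv hf
  rw [Fin.sum_univ_two] at this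
  rw [Nat.cast_smul_eq_nsmul, ← this]
  rfl

variable {a b : ℕ} {v : Bipoly k}

theorem rTensor_euler (hv : v ∈ bidegree k a b) : (euler k).rTensor _ v = (a : k) • v := by
  have := map_mem_of_bidegree ((euler k).rTensor _ - (a : k) • LinearMap.id) ⊥ ?_ hv
  · simpa [sub_eq_zero] using this
  · intro f hf g hg
    simp [euler_apply hf, TensorProduct.smul_tmul']

theorem lTensor_euler (hv : v ∈ bidegree k a b) : (euler k).lTensor _ v = (b : k) • v := by
  have := map_mem_of_bidegree ((euler k).lTensor _ - (b : k) • LinearMap.id) ⊥ ?_ hv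
  · simpa [sub_eq_zero] using this
  · intro f hf g hg
    simp [euler_apply hg]

theorem polarDown_mem (hv : v ∈ bidegree k (a + 1) b) : polarDown k v ∈ bidegree k a (b + 1) :=
  map_mem_of_bidegree _ _ (fun _ hf _ hg => add_mem
    (tmul_mem_bidegree (dX_mem _ hf) (mX_mem _ hg)) (tmul_mem_bidegree (dX_mem _ hf) (mX_mem _ hg))) hv

theorem polarUp_mem (hv : v ∈ bidegree k a (b + 1)) : polarUp k v ∈ bidegree k (a + 1) b :=
  map_mem_of_bidegree _ _ (fun _ hf _ hg => add_mem
    (tmul_mem_bidegree (mX_mem _ hf) (dX_mem _ hg)) (tmul_mem_bidegree (mX_mem _ hf) (dX_mem _ hg))) hv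

theorem polarUp_eq_zero (hv : v ∈ bidegree k a 0) : polarUp k v = 0 :=
  map_mem_of_bidegree _ ⊥ (fun _ _ _ hg => by simp [polarUp, dX_eq_zero _ hg]) hv

theorem cayley_mem (hv : v ∈ bidegree k (a + 1) (b + 1)) : cayley k v ∈ bidegree k a b :=
  map_mem_of_bidegree _ _ (fun _ hf _ hg => sub_mem
    (tmul_mem_bidegree (dX_mem _ hf) (dX_mem _ hg)) (tmul_mem_bidegree (dX_mem _ hf) (dX_mem _ hg))) hv

theorem cayley_eq_zero (hv : v ∈ bidegree k a 0) : cayley k v = 0 :=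
  map_mem_of_bidegree _ ⊥ (fun _ _ _ hg => by simp [cayley, dX_eq_zero _ hg]) hv

theorem mulDet_mem (hv : v ∈ bidegree k a b) : mulDet k v ∈ bidegree k (a + 1) (b + 1) :=
  map_mem_of_bidegree _ _ (fun _ hf _ hg => sub_mem
    (tmul_mem_bidegree (mX_mem _ hf) (mX_mem _ hg)) (tmul_mem_bidegree (mX_mem _ hf) (mX_mem _ hg))) hv

theorem mul'_mem (hv : v ∈ bidegree k a b) :
    LinearMap.mul' k _ v ∈ homogeneousSubmodule (Fin 2) k (a + b) :=
  map_mem_of_bidegree _ _ (fun _ hf _ hg => IsHomogeneous.mul hf hg) hv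

theorem polarDown_pow_mem (c : ℕ) (hv : v ∈ bidegree k (a + c) b) :
    (polarDown k ^ c) v ∈ bidegree k a (b + c) := by
  induction c generalizing b v with
  | zero => exact hv
  | succ c ih =>
    rw [pow_succ, Module.End.mul_apply, add_comm c, ← add_assoc]
    exact ih (polarDown_mem hv)

theorem mulDet_pow_mem (r : ℕ) (hv : v ∈ bidegree k a b) :
    (mulDet k ^ r) v ∈ bidegree k (a + r) (b + r) := by
  induction r with
  | zero => exact hv
  | succ r ih =>
    rw [pow_succ', Module.End.mul_apply]
    exact mulDet_mem ih

theorem cayley_pow_mem (r : ℕ) (hv : v ∈ bidegree k (a + r) (b + r)) :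
    (cayley k ^ r) v ∈ bidegree k a b := by
  induction r generalizing v with
  | zero => exact hv
  | succ r ih =>
    rw [pow_succ, Module.End.mul_apply]
    exact ih (cayley_mem hv)

theorem polarUp_pow_mem (r : ℕ) (hv : v ∈ bidegree k a (b + r)) :
    (polarUp k ^ r) v ∈ bidegree k (a + r) b := by
  induction r generalizing a v with
  | zero => exact hv
  | succ r ih =>
    rw [pow_succ, Module.End.mul_apply, add_comm r, ← add_assoc]
    exact ih (polarUp_mem hv)

theorem polarUp_pow_eq_zero {r : ℕ} (hr : b < r) (hv : v ∈ bidegree k a b) :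
    (polarUp k ^ r) v = 0 := by
  obtain ⟨s, rfl⟩ : ∃ s, r = s + (b + 1) := ⟨r - (b + 1), by omega⟩
  rw [pow_add, Module.End.mul_apply, pow_succ', Module.End.mul_apply, polarUp_eq_zero, map_zero]
  apply polarUp_pow_mem (a := a) (b := 0) b
  rwa [zero_add]

theorem cayley_pow_eq_zero {r : ℕ} (hr : b < r) (hv : v ∈ bidegree k a b) :
    (cayley k ^ r) v = 0 := by
  induction b generalizing a r v with
  | zero =>
    obtain ⟨s, rfl⟩ : ∃ s, r = s + 1 := ⟨r - 1, by omega⟩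
    rw [pow_succ, Module.End.mul_apply, cayley_eq_zero hv, map_zero]
  | succ b ih =>
    obtain ⟨s, rfl⟩ : ∃ s, r = s + 1 := ⟨r - 1, by omega⟩
    rw [pow_succ, Module.End.mul_apply]
    rcases a with _ | a
    · have : cayley k v = 0 :=
        map_mem_of_bidegree _ ⊥ (fun _ hf _ _ => by simp [cayley, dX_eq_zero _ hf]) hv
      rw [this, map_zero]
    · exact ih (by omega) (cayley_mem hv)

/-- The action of a raising operator on a string generated by a primitive vector. -/
theorem apply_pow_succ_of_primitive {M : Type*} [AddCommGroup M] [Module k M]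
    (e f : Module.End k M) (c : ℕ → k) (x : M) (he : e x = 0)
    (h : ∀ l, e (f ((f ^ l) x)) = f (e ((f ^ l) x)) + c l • (f ^ l) x) (j : ℕ) :
    e ((f ^ (j + 1)) x) = (∑ l ∈ Finset.range (j + 1), c l) • (f ^ j) x := by
  induction j with
  | zero =>
    have := h 0
    simp only [pow_zero, Module.End.one_apply, he, map_zero, zero_add] at this
    simp [this]
  | succ j ih =>
    rw [pow_succ', Module.End.mul_apply, h, ih, map_smul, Finset.sum_range_succ _ (j + 1), add_smul,
      ← Module.End.mul_apply f, ← pow_succ']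

theorem cayley_mulDet_pow (hv : v ∈ bidegree k a b) (h0 : cayley k v = 0) (j : ℕ) :
    cayley k ((mulDet k ^ (j + 1)) v) =
      (((j + 1) * (a + b + 2 + j) : ℕ) : k) • (mulDet k ^ j) v := by
  rw [apply_pow_succ_of_primitive (cayley k) (mulDet k) (fun l => (a + b + 2 + 2 * l : k)) v h0]
  · congr 1
    push_cast
    induction j with
    | zero => simp
    | succ j ih =>
      rw [Finset.sum_range_succ, ih]
      push_cast
      ring
  · intro l
    have := mulDet_pow_mem l hv
    rw [cayley_mulDet, rTensor_euler this, lTensor_euler this, ← add_smul, ← add_smul]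
    congr 2
    push_cast
    ring

/-- Iterates `cayley_mulDet_pow`; the explicit product is needed to see that the scalar is nonzero
modulo `p` in the relevant range. -/
theorem cayley_pow_mulDet_pow (hv : v ∈ bidegree k a b) (h0 : cayley k v = 0) (r : ℕ) :
    (cayley k ^ r) ((mulDet k ^ r) v) =
      ((∏ j ∈ Finset.range r, ((j + 1) * (a + b + 2 + j)) : ℕ) : k) • v := by
  induction r with
  | zero => simp
  | succ r ih =>
    rw [pow_succ (cayley k), Module.End.mul_apply, cayley_mulDet_pow hv h0, map_smul, ih, smul_smul,
      Finset.prod_range_succ]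
    congr 1
    push_cast
    ring

theorem cayley_pow_mulDet_pow_of_lt (hv : v ∈ bidegree k a b) (h0 : cayley k v = 0) {r s : ℕ}
    (hrs : r < s) : (cayley k ^ s) ((mulDet k ^ r) v) = 0 := by
  obtain ⟨t, rfl⟩ : ∃ t, s = t + 1 + r := ⟨s - (r + 1), by omega⟩
  rw [pow_add, Module.End.mul_apply, cayley_pow_mulDet_pow hv h0, map_smul, pow_succ,
    Module.End.mul_apply, h0, map_zero, smul_zero]

theorem mul'_cayley_pow_mulDet_pow_of_lt (hv : v ∈ bidegree k a b) (h0 : cayley k v = 0) {r s : ℕ}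
    (hsr : s < r) : LinearMap.mul' k _ ((cayley k ^ s) ((mulDet k ^ r) v)) = 0 := by
  have : ∃ c : k, (cayley k ^ s) ((mulDet k ^ r) v) = c • (mulDet k ^ (r - s)) v := by
    induction s with
    | zero => exact ⟨1, by simp⟩
    | succ s ih =>
      obtain ⟨c, hc⟩ := ih (by omega)
      obtain ⟨t, ht⟩ : ∃ t, r - s = t + 1 := ⟨r - s - 1, by omega⟩
      refine ⟨c * (((t + 1) * (a + b + 2 + t) : ℕ) : k), ?_⟩
      rw [pow_succ', Module.End.mul_apply, hc, map_smul, ht, cayley_mulDet_pow hv h0, smul_smul,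
        show r - (s + 1) = t by omega]
  obtain ⟨c, hc⟩ := this
  obtain ⟨t, ht⟩ : ∃ t, r - s = t + 1 := ⟨r - s - 1, by omega⟩
  rw [hc, map_smul, ht, pow_succ', Module.End.mul_apply, mul'_mulDet, smul_zero]

theorem mul'_polarDown_pow (c : ℕ) (hv : v ∈ bidegree k (a + c) b) :
    LinearMap.mul' k _ ((polarDown k ^ c) v) =
      (((a + c).descFactorial c : ℕ) : k) • LinearMap.mul' k _ v := by
  induction c generalizing a with
  | zero => simp
  | succ c ih =>
    rw [pow_succ', Module.End.mul_apply, mul'_polarDown, rTensor_euler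
      (polarDown_pow_mem (a := a + 1) c (by rwa [add_assoc, add_comm 1 c])), map_smul,
      ih (a := a + 1) (by rwa [add_assoc, add_comm 1 c]), smul_smul, Nat.descFactorial_succ]
    congr 1
    rw [show a + 1 + c = a + (c + 1) by ring, show a + (c + 1) - c = a + 1 by omega]
    push_cast
    ring

section Char

variable (p : ℕ) [CharP k p]

/-- In an `sl_2`-string a vector killed by the lowering operator cannot have positive weight `a -
b`. Applying `polarUp` repeatedly to `v` reaches zero after `b + 1` steps, while `polarDown` leads
back with the factors `(j + 1) * (b - a - j)`, which are nonzero modulo `p` because `a - b + j ≤ a <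
p`. -/
theorem eq_zero_of_polarDown (hb : b < a) (ha : a < p) (hv : v ∈ bidegree k a b)
    (h0 : polarDown k v = 0) : v = 0 := by
  have key := apply_pow_succ_of_primitive (polarDown k) (polarUp k)
    (fun l => (b - a - 2 * l : k)) v h0 (by
      intro l
      by_cases hl : l ≤ b
      · obtain ⟨c, rfl⟩ : ∃ c, b = c + l := ⟨b - l, by omega⟩
        have := polarUp_pow_mem l hv
        rw [polarDown_polarUp, rTensor_euler this, lTensor_euler this]
        congr 1
        push_cast
        module
      · simp [polarUp_pow_eq_zero (not_le.1 hl) hv])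
  have hsum : ∀ j : ℕ, ∑ l ∈ Finset.range (j + 1), (b - a - 2 * l : k) =
      (j + 1 : k) * (b - a - j) := by
    intro j
    induction j with
    | zero => simp
    | succ j ih =>
      rw [Finset.sum_range_succ, ih]
      push_cast
      ring
  have hne : ∀ j ≤ b, (∑ l ∈ Finset.range (j + 1), (b - a - 2 * l : k)) ≠ 0 := by
    intro j hj
    rw [hsum]
    have h1 := natCast_ne_zero_of_lt k p (a := j + 1) (by omega) (by omega)
    have h2 := natCast_ne_zero_of_lt k p (a := a - b + j) (by omega) (by omega)
    rw [Nat.cast_add, Nat.cast_sub hb.le] at h2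
    push_cast at h1
    refine mul_ne_zero h1 ?_
    rw [show (b - a - j : k) = -(a - b + j) by ring]
    exact neg_ne_zero.2 h2
  -- Descend from `polarUp ^ (b + 1)`, which is zero for degree reasons, to `v` itself.
  have hz : ∀ j ≤ b + 1, (polarUp k ^ (b + 1 - j)) v = 0 := by
    intro j
    induction j with
    | zero => intro _; exact polarUp_pow_eq_zero (by omega) hv
    | succ j ih =>
      intro hj
      have h1 := key (b + 1 - (j + 1))
      rw [show b + 1 - (j + 1) + 1 = b + 1 - j by omega, ih (by omega), map_zero] at h1
      have h2 := hne (b + 1 - (j + 1)) (by omega)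
      rw [show b + 1 - (j + 1) + 1 = b + 1 - j by omega] at h2
      exact (smul_eq_zero.1 h1.symm).resolve_left h2
  simpa using hz (b + 1) le_rfl

/-- The last of the `c` steps starts in bidegree `(a + 1, b + c - 1)`, and `hb` says that the weight
is still positive there. -/
theorem eq_zero_of_polarDown_pow (c : ℕ) (hb : b + 2 * c ≤ a + c + 1) (ha : a + c < p)
    (hv : v ∈ bidegree k (a + c) b) (h0 : (polarDown k ^ c) v = 0) : v = 0 := by
  induction c generalizing b v with
  | zero => simpa using h0
  | succ c ih =>
    rw [pow_succ, Module.End.mul_apply] at h0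
    exact eq_zero_of_polarDown p (by omega) ha hv (ih (by omega) (by omega) (polarDown_mem hv) h0)

end Char

end Bidegree

end Operators

/-! ### Equivariance of the operators. -/

section Equivariance

variable {k : Type u} [Field k] {p : ℕ} [CharP k p]

theorem dX_subst (A : G p) (j : Fin 2) (f : MvPolynomial (Fin 2) k) :
    dX k j (subst k p A f) = ∑ i, entry k p A j i • subst k p A (dX k i f) := by
  induction f using MvPolynomial.induction_on with
  | C a => simp [dX, subst]
  | add f g hf hg => simp only [map_add, hf, hg, smul_add, Finset.sum_add_distrib]
  | mul_X f l hf =>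
    simp only [dX, Derivation.coeFn_coe, map_mul, Derivation.leibniz, map_add, smul_eq_mul] at hf ⊢
    rw [hf, Fin.sum_univ_two, Fin.sum_univ_two]
    fin_cases l <;> fin_cases j <;>
      simp [subst, pderiv_X, smul_eq_C_mul, Derivation.leibniz] <;> ring

theorem subst_mX (A : G p) (i : Fin 2) (f : MvPolynomial (Fin 2) k) :
    subst k p A (mX k i f) = ∑ j, entry k p A j i • mX k j (subst k p A f) := by
  simp only [mX, LinearMap.mulLeft_apply, map_mul, Fin.sum_univ_two]
  fin_cases i <;> simp [subst, smul_eq_C_mul] <;> ring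

theorem entry_det (A : G p) :
    entry k p A 0 0 * entry k p A 1 1 - entry k p A 0 1 * entry k p A 1 0 = 1 := by
  have := A.2
  rw [Matrix.det_fin_two] at this
  rw [← map_mul, ← map_mul, ← map_sub, this, map_one]

variable (k p) in
/-- The diagonal substitution in both pairs of variables. -/
def bisubst (A : G p) : Module.End k (Bipoly k) :=
  TensorProduct.map (subst k p A).toLinearMap (subst k p A).toLinearMap

theorem bisubst_tmul (A : G p) (f g : MvPolynomial (Fin 2) k) :
    bisubst k p A (f ⊗ₜ g) = subst k p A f ⊗ₜ subst k p A g := rfl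

theorem polarDown_bisubst (A : G p) (v : Bipoly k) :
    polarDown k (bisubst k p A v) = bisubst k p A (polarDown k v) := by
  induction v using TensorProduct.induction_on with
  | zero => simp
  | add x y hx hy => simp only [map_add, hx, hy]
  | tmul f g =>
    simp only [polarDown, LinearMap.add_apply, TensorProduct.map_tmul, bisubst_tmul, map_add,
      dX_subst, subst_mX, Fin.sum_univ_two, TensorProduct.add_tmul, TensorProduct.tmul_add,
      TensorProduct.smul_tmul', TensorProduct.tmul_smul]
    abel

theorem cayley_bisubst (A : G p) (v : Bipoly k) :
    cayley k (bisubst k p A v) = bisubst k p A (cayley k v) := by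
  induction v using TensorProduct.induction_on with
  | zero => simp
  | add x y hx hy => simp only [map_add, hx, hy]
  | tmul f g =>
    rw [← one_smul k (bisubst k p A (cayley k (f ⊗ₜ g))), ← entry_det A]
    simp only [cayley, LinearMap.sub_apply, TensorProduct.map_tmul, bisubst_tmul, map_sub,
      dX_subst, Fin.sum_univ_two, TensorProduct.add_tmul, TensorProduct.tmul_add,
      ← TensorProduct.smul_tmul', TensorProduct.tmul_smul]
    module

theorem mulDet_bisubst (A : G p) (v : Bipoly k) :
    mulDet k (bisubst k p A v) = bisubst k p A (mulDet k v) := by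
  induction v using TensorProduct.induction_on with
  | zero => simp
  | add x y hx hy => simp only [map_add, hx, hy]
  | tmul f g =>
    rw [← one_smul k (mulDet k _), ← entry_det A]
    simp only [mulDet, LinearMap.sub_apply, TensorProduct.map_tmul, bisubst_tmul, map_sub,
      subst_mX, Fin.sum_univ_two, TensorProduct.add_tmul, TensorProduct.tmul_add,
      ← TensorProduct.smul_tmul', TensorProduct.tmul_smul]
    module

theorem mul'_bisubst (A : G p) (v : Bipoly k) :
    LinearMap.mul' k _ (bisubst k p A v) = subst k p A (LinearMap.mul' k _ v) := by
  induction v using TensorProduct.induction_on with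
  | zero => simp
  | add x y hx hy => simp only [map_add, hx, hy]
  | tmul f g => simp [bisubst_tmul]

theorem pow_bisubst {F : Module.End k (Bipoly k)} {A : G p}
    (h : ∀ v, F (bisubst k p A v) = bisubst k p A (F v)) (r : ℕ) (v : Bipoly k) :
    (F ^ r) (bisubst k p A v) = bisubst k p A ((F ^ r) v) := by
  have : Commute F (bisubst k p A) := LinearMap.ext h
  exact DFunLike.congr_fun (this.pow_left r).eq v

end Equivariance

/-! ### Combinatorics of the strings. -/

section Strings

theorem mem_nmString {n m i : ℕ} : i ∈ nmString n m ↔ ∃ r < m, n + m - 1 - 2 * r = i := by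
  simp [nmString]

variable {p n m i : ℕ}

/-- The reflection `i ↦ 2p - i` sends the index `r` to `n + m - p - 1 - r`, which is a natural
number exactly when `r < n + m - p`. -/
theorem mem_unpaired (hm : 1 ≤ m) (hmn : m ≤ n) (hnp : n ≤ p) :
    i ∈ unpaired p n m ↔ ∃ r, n + m - p ≤ r ∧ r < m ∧ i = n + m - 1 - 2 * r := by
  simp only [unpaired, Finset.mem_filter, Finset.mem_inter, mem_nmString, Finset.mem_Icc]
  constructor
  · rintro ⟨⟨⟨r, hr, rfl⟩, h1, h2⟩, h3⟩
    refine ⟨r, ?_, hr, rfl⟩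
    by_contra hc
    exact h3 ⟨n + m - 1 - r - p, by omega, by omega⟩
  · rintro ⟨r, h1, hr, rfl⟩
    refine ⟨⟨⟨r, hr, rfl⟩, by omega, by omega⟩, ?_⟩
    rintro ⟨j, hj, h⟩
    omega

theorem mem_paired (hm : 1 ≤ m) (hmn : m ≤ n) (hnp : n ≤ p) :
    i ∈ paired p n m ↔ ∃ r < n + m - p, i = n + m - 1 - 2 * r ∧ i ≤ p := by
  simp only [paired, Finset.mem_filter, Finset.mem_inter, mem_nmString, Finset.mem_Icc]
  constructor
  · rintro ⟨⟨⟨r, hr, rfl⟩, h1, h2⟩, j, hj, h⟩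
    exact ⟨r, by omega, rfl, h2⟩
  · rintro ⟨r, hr, rfl, h⟩
    exact ⟨⟨⟨r, by omega, rfl⟩, by omega, by omega⟩, n + m - 1 - r - p, by omega, by omega⟩

/-- The description in `mem_paired` depends only on `n + m`, so `V_n ⊗ V_m` and `V_p ⊗ V_(n + m -
p)` have the same paired elements. -/
theorem paired_eq (hm : 1 ≤ m) (hmn : m ≤ n) (hnp : n ≤ p) (h : p < n + m) :
    paired p n m = paired p p (n + m - p) := by
  ext i
  rw [mem_paired hm hmn hnp, mem_paired (by omega) (by omega) le_rfl,
    show p + (n + m - p) = n + m by omega]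

theorem paired_eq_empty (hm : 1 ≤ m) (hmn : m ≤ n) (hnp : n ≤ p) (h : n + m ≤ p) :
    paired p n m = ∅ := by
  ext i
  rw [mem_paired hm hmn hnp, Nat.sub_eq_zero_of_le h]
  simp

theorem sum_unpaired (hm : 1 ≤ m) (hmn : m ≤ n) (hnp : n ≤ p) :
    ∑ i ∈ unpaired p n m, i = (m - (n + m - p)) * (n - (n + m - p)) := by
  have h1 : unpaired p n m =
      (Finset.range (m - (n + m - p))).image (fun s => n + m - 1 - 2 * (n + m - p + s)) := by
    ext i
    rw [mem_unpaired hm hmn hnp, Finset.mem_image]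
    constructor
    · rintro ⟨r, h1, h2, rfl⟩
      exact ⟨r - (n + m - p), by rw [Finset.mem_range]; omega, by congr 2; omega⟩
    · rintro ⟨s, hs, rfl⟩
      rw [Finset.mem_range] at hs
      exact ⟨n + m - p + s, by omega, by omega, rfl⟩
  rw [h1, Finset.sum_image]
  · set c := n + m - p
    obtain ⟨d, hd⟩ : ∃ d, m = c + d := ⟨m - c, by omega⟩
    obtain ⟨e, he⟩ : ∃ e, n = c + d + e := ⟨n - m, by omega⟩
    rw [he, hd, show c + d - c = d by omega, show c + d + e - c = d + e by omega]
    clear_value c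
    -- Partial sums of an arithmetic progression with difference `-2`; writing `n` and `m` through
    -- `c`, `d`, `e` avoids truncated subtraction.
    have h2 : ∀ d' ≤ d, ∑ s ∈ Finset.range d', (c + d + e + (c + d) - 1 - 2 * (c + s)) =
        d' * (2 * d + e - d') := by
      intro d'
      induction d' with
      | zero => simp
      | succ d' ih =>
        intro hd'
        rw [Finset.sum_range_succ, ih (by omega)]
        obtain ⟨f, rfl⟩ : ∃ f, d = d' + 1 + f := ⟨d - (d' + 1), by omega⟩
        rw [show 2 * (d' + 1 + f) + e - d' = d' + 2 + 2 * f + e by omega,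
          show 2 * (d' + 1 + f) + e - (d' + 1) = d' + 1 + 2 * f + e by omega,
          show c + (d' + 1 + f) + e + (c + (d' + 1 + f)) - 1 - 2 * (c + d') = 1 + 2 * f + e by omega]
        ring
    rw [h2 d le_rfl, show 2 * d + e - d = d + e by omega]
  · intro s hs t ht h
    simp only [Finset.coe_range, Set.mem_Iio] at hs ht
    dsimp only at h
    omega

end Strings

/-! ### Transvectants, inclusions and polarizations as intertwining maps. -/

section Transvectants

variable {k : Type u} [Field k] {p : ℕ} [CharP k p]

variable (k) in
/-- The inclusion of `V_n ⊗ V_m` in the polynomials in two pairs of variables. -/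
def emb (n m : ℕ) : VSpace k n ⊗[k] VSpace k m →ₗ[k] Bipoly k :=
  TensorProduct.map (Submodule.subtype _) (Submodule.subtype _)

theorem emb_injective (n m : ℕ) : Function.Injective (emb k n m) :=
  TensorProduct.map_injective_of_flat_flat _ _ (Submodule.injective_subtype _)
    (Submodule.injective_subtype _)

theorem emb_tmul {n m : ℕ} (f : VSpace k n) (g : VSpace k m) : emb k n m (f ⊗ₜ g) = f.1 ⊗ₜ g.1 := rfl

theorem emb_mem (n m : ℕ) (x : VSpace k n ⊗[k] VSpace k m) :
    emb k n m x ∈ bidegree k (n - 1) (m - 1) := by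
  induction x using TensorProduct.induction_on with
  | zero => simp
  | add x y hx hy => rw [map_add]; exact add_mem hx hy
  | tmul f g => exact tmul_mem_bidegree f.2 g.2

theorem emb_mem_of_eq {n m a b : ℕ} (hn : n - 1 = a) (hm : m - 1 = b)
    (x : VSpace k n ⊗[k] VSpace k m) : emb k n m x ∈ bidegree k a b := by
  subst hn hm
  exact emb_mem n m x

theorem mem_range_emb {n m : ℕ} {v : Bipoly k} (hv : v ∈ bidegree k (n - 1) (m - 1)) :
    v ∈ LinearMap.range (emb k n m) :=
  map_mem_of_bidegree LinearMap.id _ (fun f hf g hg =>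
    LinearMap.mem_range.2 ⟨(⟨f, hf⟩ : VSpace k n) ⊗ₜ (⟨g, hg⟩ : VSpace k m), rfl⟩) hv

theorem emb_tprod (n m : ℕ) (A : G p) (x : VSpace k n ⊗[k] VSpace k m) :
    emb k n m ((V k p n).tprod (V k p m) A x) = bisubst k p A (emb k n m x) := by
  induction x using TensorProduct.induction_on with
  | zero => simp
  | add x y hx hy => simp only [map_add, hx, hy]
  | tmul f g => rfl

/-- An equivariant map to the polynomials in two pairs of variables whose values have the right
bidegree is a map to `V_n ⊗ V_m`. -/
def liftEmb {M : Type*} [AddCommMonoid M] [Module k M] (ρ : Representation k (G p) M) (n m : ℕ)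
    (F : M →ₗ[k] Bipoly k) (h : ∀ x, F x ∈ bidegree k (n - 1) (m - 1))
    (hF : ∀ A x, F (ρ A x) = bisubst k p A (F x)) :
    ρ.IntertwiningMap ((V k p n).tprod (V k p m)) :=
  LinearMap.intertwiningMap_of_isIntertwiningMap ρ _
    ((LinearEquiv.ofInjective (emb k n m) (emb_injective n m)).symm.toLinearMap ∘ₗ
      F.codRestrict _ (fun x => mem_range_emb (h x))) (by
    intro A x
    apply emb_injective n m
    rw [emb_tprod]
    have key : ∀ y, emb k n m ((LinearEquiv.ofInjective (emb k n m) (emb_injective n m)).symm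
        (F.codRestrict _ (fun x => mem_range_emb (h x)) y)) = F y := fun y =>
      congrArg Subtype.val (LinearEquiv.apply_symm_apply
        (LinearEquiv.ofInjective (emb k n m) (emb_injective n m)) _)
    simp only [LinearMap.comp_apply, LinearEquiv.coe_coe, key, hF])

theorem emb_liftEmb {M : Type*} [AddCommMonoid M] [Module k M] {ρ : Representation k (G p) M}
    {n m : ℕ} {F : M →ₗ[k] Bipoly k} {h : ∀ x, F x ∈ bidegree k (n - 1) (m - 1)}
    {hF : ∀ A x, F (ρ A x) = bisubst k p A (F x)} (x : M) :
    emb k n m (liftEmb ρ n m F h hF x) = F x :=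
  congrArg Subtype.val (LinearEquiv.apply_symm_apply
    (LinearEquiv.ofInjective (emb k n m) (emb_injective n m)) _)

variable (k p) in
/-- The transvectant `V_n ⊗ V_m → V_i`: Cayley's operator applied `r` times, followed by
multiplication. -/
def transvectant {n m i a b : ℕ} (r : ℕ) (hn : n - 1 = a + r) (hm : m - 1 = b + r)
    (hi : i - 1 = a + b) : ((V k p n).tprod (V k p m)).IntertwiningMap (V k p i) :=
  LinearMap.intertwiningMap_of_isIntertwiningMap _ _
    ((LinearMap.mul' k _ ∘ₗ (cayley k ^ r) ∘ₗ emb k n m).codRestrict _ (fun x => by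
      rw [hi]
      exact mul'_mem (cayley_pow_mem r (emb_mem_of_eq hn hm x)))) (by
    intro A x
    apply Subtype.ext
    change LinearMap.mul' k _ ((cayley k ^ r) (emb k n m _)) =
      subst k p A (LinearMap.mul' k _ ((cayley k ^ r) (emb k n m x)))
    rw [emb_tprod, pow_bisubst (cayley_bisubst A), mul'_bisubst])

theorem transvectant_coe {n m i a b : ℕ} (r : ℕ) (hn : n - 1 = a + r) (hm : m - 1 = b + r)
    (hi : i - 1 = a + b) (x : VSpace k n ⊗[k] VSpace k m) :
    (transvectant k p r hn hm hi x : MvPolynomial (Fin 2) k) =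
      LinearMap.mul' k _ ((cayley k ^ r) (emb k n m x)) := rfl

variable (k) in
/-- The polarization of a form in one pair of variables. -/
def polarize (b : ℕ) : MvPolynomial (Fin 2) k →ₗ[k] Bipoly k :=
  (polarDown k ^ b) ∘ₗ (TensorProduct.mk k _ _).flip 1

theorem one_mem : (1 : MvPolynomial (Fin 2) k) ∈ homogeneousSubmodule (Fin 2) k 0 :=
  isHomogeneous_one _ _

theorem polarize_mem {a b : ℕ} {f : MvPolynomial (Fin 2) k}
    (hf : f ∈ homogeneousSubmodule (Fin 2) k (a + b)) : polarize k b f ∈ bidegree k a b := by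
  have := polarDown_pow_mem b (tmul_mem_bidegree hf one_mem)
  rwa [zero_add] at this

/-- `cayley` commutes with `polarDown` and kills `f ⊗ 1`. Polarized forms are thus the primitive
vectors for `cayley` and `mulDet`. -/
theorem cayley_polarize (b : ℕ) (f : MvPolynomial (Fin 2) k) : cayley k (polarize k b f) = 0 := by
  have h1 : cayley k (f ⊗ₜ 1) = 0 := by
    simp [cayley, dX_eq_zero _ one_mem]
  change (cayley k * polarDown k ^ b) _ = 0
  rw [(commute_cayley_polarDown.pow_right b).eq]
  exact (congrArg (polarDown k ^ b) h1).trans (map_zero _)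

theorem mul'_polarize {a b : ℕ} {f : MvPolynomial (Fin 2) k}
    (hf : f ∈ homogeneousSubmodule (Fin 2) k (a + b)) :
    LinearMap.mul' k _ (polarize k b f) = (((a + b).descFactorial b : ℕ) : k) • f := by
  have := mul'_polarDown_pow b (tmul_mem_bidegree hf one_mem)
  rw [LinearMap.mul'_apply, mul_one] at this
  exact this

theorem polarize_subst (b : ℕ) (A : G p) (f : MvPolynomial (Fin 2) k) :
    polarize k b (subst k p A f) = bisubst k p A (polarize k b f) := by
  rw [polarize, LinearMap.comp_apply, LinearMap.comp_apply, ← pow_bisubst (polarDown_bisubst A)]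
  simp [bisubst_tmul]

variable (k p) in
/-- The inclusion `V_i → V_n ⊗ V_m`: polarization followed by multiplication by the `r`-th power of
the determinant. -/
def insertion {n m i a b : ℕ} (r : ℕ) (hn : n - 1 = a + r) (hm : m - 1 = b + r)
    (hi : i - 1 = a + b) : (V k p i).IntertwiningMap ((V k p n).tprod (V k p m)) :=
  liftEmb _ n m ((mulDet k ^ r) ∘ₗ polarize k b ∘ₗ Submodule.subtype _) (fun x => by
    rw [hn, hm]
    exact mulDet_pow_mem r (polarize_mem (hi ▸ x.2))) (fun A x => by
    simp only [LinearMap.comp_apply, Submodule.subtype_apply, V_apply_coe, polarize_subst]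
    rw [pow_bisubst (mulDet_bisubst A)])

theorem emb_insertion {n m i a b : ℕ} (r : ℕ) (hn : n - 1 = a + r) (hm : m - 1 = b + r)
    (hi : i - 1 = a + b) (x : VSpace k i) :
    emb k n m (insertion k p r hn hm hi x) = (mulDet k ^ r) (polarize k b x.1) :=
  emb_liftEmb x

/-- If `r < r'`, there are more Cayley operators than determinants and the primitive vector is
reached and killed. If `r > r'`, a factor of the determinant remains and multiplication kills it. -/
theorem transvectant_insertion_of_ne {n m i a b i' a' b' : ℕ} {r r' : ℕ} (hn : n - 1 = a + r)
    (hm : m - 1 = b + r) (hi : i - 1 = a + b) (hn' : n - 1 = a' + r') (hm' : m - 1 = b' + r')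
    (hi' : i' - 1 = a' + b') (hr : r ≠ r') (x : VSpace k i) :
    transvectant k p r' hn' hm' hi' (insertion k p r hn hm hi x) = 0 := by
  have hx : x.1 ∈ homogeneousSubmodule (Fin 2) k (a + b) := hi ▸ x.2
  apply Subtype.ext
  rw [transvectant_coe, emb_insertion]
  rcases hr.lt_or_gt with h | h
  · rw [cayley_pow_mulDet_pow_of_lt (polarize_mem hx) (cayley_polarize b _) h, map_zero]
    rfl
  · exact mul'_cayley_pow_mulDet_pow_of_lt (polarize_mem hx) (cayley_polarize b _) h

/-- The scalar is a product of integers between `1` and `a + b + r + 1`, so `hr` makes it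
invertible. -/
theorem transvectant_insertion [Fact p.Prime] {n m i a b : ℕ} {r : ℕ} (hn : n - 1 = a + r)
    (hm : m - 1 = b + r) (hi : i - 1 = a + b) (hr : a + b + r + 1 < p) :
    ∃ c : k, c ≠ 0 ∧ ∀ x : VSpace k i,
      transvectant k p r hn hm hi (insertion k p r hn hm hi x) = c • x := by
  refine ⟨((∏ j ∈ Finset.range r, ((j + 1) * (a + b + 2 + j)) : ℕ) : k) *
    (((a + b).descFactorial b : ℕ) : k), mul_ne_zero ?_ ?_, ?_⟩
  · rw [Nat.cast_prod]
    refine Finset.prod_ne_zero_iff.2 fun j hj => ?_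
    rw [Finset.mem_range] at hj
    rw [Nat.cast_mul]
    exact mul_ne_zero (natCast_ne_zero_of_lt k p (by omega) (by omega))
      (natCast_ne_zero_of_lt k p (by omega) (by omega))
  · rw [Nat.descFactorial_eq_factorial_mul_choose, Nat.cast_mul]
    exact mul_ne_zero (factorial_ne_zero_of_lt k p (by omega))
      (choose_ne_zero_of_lt k p (by omega) (by omega))
  · intro x
    have hx : x.1 ∈ homogeneousSubmodule (Fin 2) k (a + b) := hi ▸ x.2
    apply Subtype.ext
    rw [transvectant_coe, emb_insertion,
      cayley_pow_mulDet_pow (polarize_mem hx) (cayley_polarize b _), map_smul, mul'_polarize hx,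
      smul_smul]
    rfl

variable (k p) in
/-- The polarization `V_q ⊗ V_l → V_n ⊗ V_m`, where `n = q - c` and `m = l + c`. -/
def polarization {q l n m : ℕ} (c : ℕ) (hq : q - 1 = n - 1 + c) (hl : m - 1 = l - 1 + c) :
    ((V k p q).tprod (V k p l)).IntertwiningMap ((V k p n).tprod (V k p m)) :=
  liftEmb _ n m ((polarDown k ^ c) ∘ₗ emb k q l) (fun x => by
    rw [hl]
    exact polarDown_pow_mem c (emb_mem_of_eq hq rfl x)) (fun A x => by
    simp only [LinearMap.comp_apply, emb_tprod]
    rw [pow_bisubst (polarDown_bisubst A)])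

theorem polarization_injective {q l n m : ℕ} (c : ℕ) (hq : q - 1 = n - 1 + c)
    (hl : m - 1 = l - 1 + c) (h : l - 1 + 2 * c ≤ q) (hqp : q - 1 < p) :
    Function.Injective (polarization k p c hq hl) := by
  rw [injective_iff_map_eq_zero]
  intro x hx
  have hx' := congrArg (emb k n m) hx
  rw [polarization, emb_liftEmb, map_zero] at hx'
  apply emb_injective q l
  rw [map_zero]
  exact eq_zero_of_polarDown_pow p c (by omega) (by omega) (emb_mem_of_eq hq rfl x) hx'

/-- After commuting past `polarDown`, `cayley` is applied more often than the second degree `l - 1`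
allows. -/
theorem transvectant_polarization {q l n m i a b r : ℕ} (c : ℕ) (hq : q - 1 = n - 1 + c)
    (hl : m - 1 = l - 1 + c) (hn : n - 1 = a + r) (hm : m - 1 = b + r)
    (hi : i - 1 = a + b) (hr : l - 1 < r) (x : VSpace k q ⊗[k] VSpace k l) :
    transvectant k p r hn hm hi (polarization k p c hq hl x) = 0 := by
  apply Subtype.ext
  rw [transvectant_coe, polarization, emb_liftEmb]
  have h : (cayley k ^ r) (((polarDown k ^ c) ∘ₗ emb k q l) x) =
      (polarDown k ^ c) ((cayley k ^ r) (emb k q l x)) :=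
    DFunLike.congr_fun ((commute_cayley_polarDown.pow_pow r c).eq) (emb k q l x)
  rw [h, cayley_pow_eq_zero hr (emb_mem q l x), map_zero, map_zero]
  rfl

end Transvectants

/-! ### Splitting off the unpaired summands. -/

section Splitting

/-- A family of split subrepresentations, orthogonal to each other and to a further
subrepresentation, gives a direct sum decomposition if the dimensions add up. -/
theorem exists_equiv_directSum_prod {k G ι T N : Type*} {M : ι → Type*} [Field k] [Group G]
    [Fintype ι] [∀ i, AddCommGroup (M i)] [∀ i, Module k (M i)] [∀ i, Module.Finite k (M i)]
    [AddCommGroup T] [Module k T] [Module.Finite k T] [AddCommGroup N] [Module k N]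
    [Module.Finite k N] (ρ : ∀ i, Representation k G (M i)) (τ : Representation k G T)
    (σ : Representation k G N) (ins : ∀ i, (ρ i).IntertwiningMap τ)
    (tr : ∀ i, τ.IntertwiningMap (ρ i)) (Θ : σ.IntertwiningMap τ)
    (hself : ∀ i, ∃ c : k, c ≠ 0 ∧ ∀ x, tr i (ins i x) = c • x)
    (hne : ∀ i j, i ≠ j → ∀ x, tr j (ins i x) = 0) (hΘ : Function.Injective Θ)
    (hΘ0 : ∀ i x, tr i (Θ x) = 0)
    (hdim : ∑ i, Module.finrank k (M i) + Module.finrank k N = Module.finrank k T) :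
    Nonempty (τ.Equiv ((Representation.directSum ρ).prod σ)) := by
  classical
  let Φ : DirectSum _ M →ₗ[k] T := DirectSum.toModule k _ _ (fun i => (ins i).toLinearMap)
  have hΦ : ∀ i x, Φ (DirectSum.lof k _ _ i x) = ins i x := fun i x =>
    DirectSum.toModule_lof (R := k) (φ := fun i => (ins i).toLinearMap) i x
  -- The matrix of the maps `tr j ∘ ins i` is diagonal with nonzero scalars, so the `tr j` read off
  -- the components and the sum is direct.
  have htr : ∀ j x, ∃ c : k, c ≠ 0 ∧ tr j (Φ x) = c • x j := by
    intro j x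
    obtain ⟨c, hc0, hc⟩ := hself j
    refine ⟨c, hc0, ?_⟩
    have : (tr j).toLinearMap ∘ₗ Φ = c • DirectSum.component k _ M j := by
      apply DirectSum.linearMap_ext
      intro i
      ext1 y
      change tr j (Φ (DirectSum.lof k _ _ i y)) =
        c • DirectSum.component k _ _ j (DirectSum.lof k _ _ i y)
      rw [hΦ]
      by_cases hij : i = j
      · subst hij
        rw [DirectSum.component.lof_self]
        exact hc y
      · rw [DirectSum.component.of, dif_neg hij, smul_zero]
        exact hne i j hij y
    exact DFunLike.congr_fun this x
  let Ψ : DirectSum _ M × N →ₗ[k] T := Φ.coprod Θ.toLinearMap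
  have hΨ : Function.Injective Ψ := by
    rw [injective_iff_map_eq_zero]
    rintro ⟨x, y⟩ hxy
    have hxy' : Φ x + Θ y = 0 := hxy
    have hx : x = 0 := by
      refine DFinsupp.ext fun j => ?_
      obtain ⟨c, hc0, hc⟩ := htr j x
      have := congrArg (tr j) hxy'
      rw [map_add, hc, hΘ0, add_zero, map_zero] at this
      exact (smul_eq_zero.1 this).resolve_left hc0
    subst hx
    rw [map_zero, zero_add] at hxy'
    rw [(injective_iff_map_eq_zero Θ).1 hΘ y hxy']
    rfl
  have hbij : Function.Bijective Ψ :=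
    ⟨hΨ, (LinearMap.injective_iff_surjective_of_finrank_eq_finrank (by
      rw [Module.finrank_prod, Module.finrank_directSum, hdim])).1 hΨ⟩
  let Ψ' : ((Representation.directSum ρ).prod σ).IntertwiningMap τ :=
    ⟨Ψ, by
      intro A
      apply LinearMap.prod_ext
      · apply DirectSum.linearMap_ext
        intro i
        ext1 x
        change Φ (DirectSum.lmap _ (DirectSum.lof k _ _ i x)) + Θ (σ A 0) =
          τ A (Φ (DirectSum.lof k _ _ i x) + Θ 0)
        rw [DirectSum.lmap_lof, hΦ, hΦ, map_zero, map_zero, add_zero, add_zero]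
        exact (ins i).isIntertwining _ _ A x
      · ext1 y
        change Φ (DirectSum.lmap (fun i => ρ i A) 0) + Θ (σ A y) = τ A (Φ 0 + Θ y)
        rw [map_zero, map_zero, zero_add, zero_add]
        exact Θ.isIntertwining _ _ A y⟩
  exact ⟨(Representation.IntertwiningMap.ofBijective Ψ' hbij).symm⟩

variable {k : Type u} [Field k] {p : ℕ} [CharP k p] [Fact p.Prime]

/-- `V_n ⊗ V_m` is the direct sum of the unpaired `V_i` and any subrepresentation of the right
dimension which is killed by the corresponding transvectants. -/
theorem exists_equiv_unpaired_prod {n m : ℕ} (hm : 1 ≤ m) (hmn : m ≤ n) (hnp : n ≤ p)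
    {N : Type*} [AddCommGroup N] [Module k N] [Module.Finite k N] (σ : Representation k (G p) N)
    (Θ : σ.IntertwiningMap ((V k p n).tprod (V k p m))) (hΘ : Function.Injective Θ)
    (hΘ0 : ∀ (i a b r : ℕ) (ha : n - 1 = a + r) (hb : m - 1 = b + r) (hi : i - 1 = a + b),
      n + m - p ≤ r → ∀ x, transvectant k p r ha hb hi (Θ x) = 0)
    (hN : (m - (n + m - p)) * (n - (n + m - p)) + Module.finrank k N = n * m) :
    Nonempty (((V k p n).tprod (V k p m)).Equiv
      ((Representation.directSum fun i : unpaired p n m => V k p (i : ℕ)).prod σ)) := by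
  have hdata : ∀ i : unpaired p n m, ∃ a b r, n - 1 = a + r ∧ m - 1 = b + r ∧
      (i : ℕ) - 1 = a + b ∧ n + m - p ≤ r ∧ a + b + r + 1 < p ∧ 1 ≤ (i : ℕ) := by
    intro i
    obtain ⟨r, h1, h2, h3⟩ := (mem_unpaired hm hmn hnp).1 i.2
    exact ⟨n - 1 - r, m - 1 - r, r, by omega, by omega, by omega, by omega, by omega, by omega⟩
  choose a b r ha hb hi hr hp h1 using hdata
  have hdim : ∑ i : unpaired p n m, Module.finrank k (VSpace k i) + Module.finrank k N =
      Module.finrank k (VSpace k n ⊗[k] VSpace k m) := by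
    rw [Module.finrank_tensorProduct, finrank_VSpace k (by omega), finrank_VSpace k hm, ← hN,
      ← sum_unpaired hm hmn hnp, ← Finset.sum_coe_sort (unpaired p n m) (fun i => i)]
    congr 1
    exact Finset.sum_congr rfl fun i _ => finrank_VSpace k (h1 i)
  refine exists_equiv_directSum_prod (T := VSpace k n ⊗[k] VSpace k m) (fun i : unpaired p n m => V k p (i : ℕ))
    ((V k p n).tprod (V k p m)) σ (fun i => insertion k p (r i) (ha i) (hb i) (hi i))
    (fun i => transvectant k p (r i) (ha i) (hb i) (hi i)) Θ
    (fun i => transvectant_insertion (ha i) (hb i) (hi i) (hp i)) ?_ hΘ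
    (fun i => hΘ0 _ _ _ _ _ _ _ (hr i)) hdim
  intro i j hij x
  refine transvectant_insertion_of_ne _ _ _ _ _ _ (fun h => hij (Subtype.ext ?_)) _
  have e1 := ha i; have e2 := hb i; have e3 := hi i; have e4 := h1 i
  have f1 := ha j; have f2 := hb j; have f3 := hi j; have f4 := h1 j
  omega

end Splitting

/-! ### Joint surjectivity and lifting to projective covers. -/

section ModuleTheory

variable {R : Type*} [Ring R]

/-- A family of maps to simple modules with no linear relation is jointly surjective. -/
theorem surjective_pi_of_isSimpleModule {ι : Type*} [Fintype ι] {Q : Type*} [AddCommMonoid Q]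
    [Module R Q] {S : ι → Type*} [∀ a, AddCommGroup (S a)] [∀ a, Module R (S a)]
    [∀ a, IsSimpleModule R (S a)] (f : ∀ a, Q →ₗ[R] S a)
    (h : ∀ j, ∀ c : ∀ a, S a →ₗ[R] S j, ∑ a, c a ∘ₗ f a = 0 → ∀ a, c a = 0) :
    Function.Surjective (LinearMap.pi f) := by
  classical
  rw [← LinearMap.range_eq_top]
  by_contra hne
  obtain ⟨C, hC⟩ := exists_isCompl (LinearMap.range (LinearMap.pi f))
  -- The product is semisimple, so the range has a complement `C`. Each coordinate of the projection
  -- to `C` is a linear relation among the `f a`, hence zero, and so `C = ⊥`.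
  let φ : (∀ a, S a) →ₗ[R] (∀ a, S a) := C.subtype ∘ₗ C.projectionOnto _ hC.symm
  have hφ : ∀ x, φ (LinearMap.pi f x) = 0 := by
    intro x
    have : C.projectionOnto _ hC.symm (LinearMap.pi f x) = 0 :=
      (Submodule.projectionOnto_apply_eq_zero_iff hC.symm).2 ⟨x, rfl⟩
    simp [φ, this]
  have h0 : φ = 0 := by
    refine LinearMap.ext fun y => funext fun j => ?_
    have hc := h j (fun a => LinearMap.proj j ∘ₗ φ ∘ₗ LinearMap.single R S a) (by
      ext x
      have := congrFun (hφ x) j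
      rw [← Finset.univ_sum_single (LinearMap.pi f x), map_sum, Finset.sum_apply] at this
      simpa [LinearMap.sum_apply] using this)
    rw [← Finset.univ_sum_single y, map_sum, Finset.sum_apply]
    exact Finset.sum_eq_zero fun a _ => DFunLike.congr_fun (hc a) (y a)
  apply hne
  have hCb : C = ⊥ := by
    rw [eq_bot_iff]
    intro y hy
    have h1 : φ y = y := by
      simp only [φ, LinearMap.comp_apply]
      exact congrArg Subtype.val (Submodule.projectionOnto_apply_left hC.symm ⟨y, hy⟩)
    rw [h0] at h1
    exact h1.symm
  have := hC.sup_eq_top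
  rwa [hCb, sup_bot_eq] at this

/-- A jointly surjective family of maps from a projective module lifts to a jointly surjective
family of maps to projective covers. -/
theorem exists_surjective_pi_cover {ι : Type*} [Fintype ι] {Q : Type*} [AddCommMonoid Q]
    [Module R Q] [Module.Projective R Q] {S P : ι → Type*} [∀ a, AddCommGroup (S a)]
    [∀ a, Module R (S a)] [∀ a, AddCommGroup (P a)] [∀ a, Module R (P a)]
    (π : ∀ a, P a →ₗ[R] S a) (hπ : ∀ a, IsProjectiveCover (π a)) (f : ∀ a, Q →ₗ[R] S a)
    (hf : Function.Surjective (LinearMap.pi f)) :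
    ∃ F : ∀ a, Q →ₗ[R] P a, Function.Surjective (LinearMap.pi F) := by
  classical
  let pr : (∀ a, P a) →ₗ[R] ∀ a, S a := LinearMap.pi fun a => π a ∘ₗ LinearMap.proj a
  have hpr : Function.Surjective pr := by
    intro y
    choose x hx using fun a => (hπ a).surjective (y a)
    exact ⟨x, funext hx⟩
  obtain ⟨F, hF⟩ := Module.projective_lifting_property pr (LinearMap.pi f) hpr
  have hFpi : LinearMap.pi (fun a => LinearMap.proj a ∘ₗ F) = F := by
    ext x a
    rfl
  refine ⟨fun a => LinearMap.proj a ∘ₗ F, ?_⟩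
  rw [hFpi]
  -- The kernel of a finite product of covers is superfluous; the kernels are removed one coordinate
  -- at a time.
  have hess : ∀ s : Finset ι, ∀ N : Submodule R (∀ a, P a),
      N ⊔ s.sup (fun a => (LinearMap.ker (π a)).map (LinearMap.single R P a)) = ⊤ → N = ⊤ := by
    intro s
    induction s using Finset.induction_on with
    | empty => simp
    | insert a s has ih =>
      intro N hN
      rw [Finset.sup_insert, ← sup_assoc] at hN
      have hN' := ih _ hN
      have h1 : N.comap (LinearMap.single R P a) ⊔ LinearMap.ker (π a) = ⊤ := by
        rw [eq_top_iff]
        intro x _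
        obtain ⟨y, hy, z, ⟨w, hw, rfl⟩, hyz⟩ :=
          Submodule.mem_sup.1 (hN' ▸ Submodule.mem_top : LinearMap.single R P a x ∈ _)
        refine Submodule.mem_sup.2 ⟨x - w, ?_, w, hw, sub_add_cancel _ _⟩
        rw [Submodule.mem_comap, map_sub, ← hyz, add_sub_cancel_right]
        exact hy
      have h2 := (hπ a).essential _ h1
      rw [← hN', left_eq_sup, Submodule.map_le_iff_le_comap, h2]
      exact le_top
  rw [← LinearMap.range_eq_top]
  apply hess Finset.univ
  rw [eq_top_iff]
  intro y _
  obtain ⟨x, hx⟩ := hf (pr y)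
  have h1 : pr (y - F x) = 0 := by
    rw [map_sub, ← hx, ← hF]
    exact sub_self _
  refine Submodule.mem_sup.2 ⟨F x, ⟨x, rfl⟩, y - F x, ?_, by abel⟩
  rw [← Finset.univ_sum_single (y - F x)]
  refine Submodule.sum_mem _ fun a ha => ?_
  exact (Finset.le_sup (f := fun a => (LinearMap.ker (π a)).map (LinearMap.single R P a)) ha)
    ⟨(y - F x) a, congrFun h1 a, rfl⟩

end ModuleTheory

/-! ### Dimension bound from invariant maps. -/

section Nilpotent

variable {k : Type*} [Field k] {M : Type*} [AddCommGroup M] [Module k M] [Module.Finite k M]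

/-- The rank of `x ^ (p - 1)` counts the Jordan blocks of size `p`. Without Jordan form: for `j < p`
the kernel of `x` on the range of `x ^ j` contains the range of `x ^ (p - 1)`, so each of the `p`
steps lowers the rank by at least that amount. -/
theorem mul_finrank_range_le {p : ℕ} (x : Module.End k M) (hx : x ^ p = 0) (hp : 1 ≤ p) :
    p * Module.finrank k (LinearMap.range (x ^ (p - 1))) ≤ Module.finrank k M := by
  have step : ∀ j < p, Module.finrank k (LinearMap.range (x ^ (j + 1))) +
      Module.finrank k (LinearMap.range (x ^ (p - 1))) ≤
      Module.finrank k (LinearMap.range (x ^ j)) := by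
    intro j hj
    let y := x.domRestrict (LinearMap.range (x ^ j))
    have h1 : LinearMap.range y = LinearMap.range (x ^ (j + 1)) := by
      rw [LinearMap.range_domRestrict, ← LinearMap.range_comp, pow_succ']
      rfl
    have h2 : LinearMap.range (x ^ (p - 1)) ≤
        (LinearMap.ker y).map (LinearMap.range (x ^ j)).subtype := by
      rintro _ ⟨z, rfl⟩
      refine ⟨⟨(x ^ (p - 1)) z, ?_⟩, ?_, rfl⟩
      · rw [show p - 1 = j + (p - 1 - j) by omega, pow_add]
        exact ⟨_, rfl⟩
      · change x ((x ^ (p - 1)) z) = 0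
        rw [← Module.End.mul_apply, ← pow_succ', Nat.sub_add_cancel hp, hx]
        rfl
    have h3 := LinearMap.finrank_range_add_finrank_ker y
    have h4 := Submodule.finrank_mono h2
    rw [Submodule.finrank_map_subtype_eq] at h4
    rw [h1] at h3
    omega
  have : ∀ j ≤ p, j * Module.finrank k (LinearMap.range (x ^ (p - 1))) ≤
      Module.finrank k (LinearMap.range (x ^ (p - j))) := by
    intro j
    induction j with
    | zero => simp
    | succ j ih =>
      intro hj
      have h1 := step (p - (j + 1)) (by omega)
      rw [show p - (j + 1) + 1 = p - j by omega] at h1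
      have h2 := ih (by omega)
      rw [Nat.succ_mul]
      omega
  refine (this p le_rfl).trans ?_
  exact Submodule.finrank_le _

end Nilpotent

section UpperInvariants

variable {k : Type u} [Field k] {p : ℕ} [Fact p.Prime] [CharP k p] {M : Type*} [AddCommMonoid M]
  [Module k M]

theorem sum_upper_eq_pow {M : Type*} [AddCommGroup M] [Module k M]
    (ρ : Representation k (G p) M) : ∑ t : ZMod p, ρ (upper t) = (ρ (upper 1) - 1) ^ (p - 1) := by
  have hp := (Fact.out : p.Prime).two_le
  have h1 : (∑ i ∈ Finset.range p, (Polynomial.X : Polynomial k) ^ i) =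
      (Polynomial.X - 1) ^ (p - 1) := by
    have h0 : (Polynomial.X - 1 : Polynomial k) ≠ 0 := by
      simpa using Polynomial.X_sub_C_ne_zero (1 : k)
    apply mul_right_cancel₀ h0
    rw [geom_sum_mul, ← pow_succ, Nat.sub_add_cancel (by omega), sub_pow_char, one_pow]
  have h2 := congrArg (Polynomial.aeval (ρ (upper 1))) h1
  simp only [map_sum, map_pow, map_sub, Polynomial.aeval_X, map_one] at h2
  rw [← h2]
  have h3 : ∀ j : ℕ, upper (p := p) (j : ZMod p) = upper 1 ^ j := by
    intro j
    induction j with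
    | zero => simp [upper_zero]
    | succ j ih => rw [pow_succ, ← ih, ← upper_add, Nat.cast_succ]
  symm
  refine Finset.sum_bij (fun j _ => (j : ZMod p)) (by simp) ?_ ?_ ?_
  · intro a ha b hb hab
    rw [Finset.mem_range] at ha hb
    have := congrArg ZMod.val hab
    rwa [ZMod.val_cast_of_lt ha, ZMod.val_cast_of_lt hb] at this
  · intro t _
    exact ⟨t.val, Finset.mem_range.2 (ZMod.val_lt t), by simp⟩
  · intro j _
    rw [h3, map_pow]

/-- The dimension of a representation which is projective over the upper unitriangular group is at
least `p` times the rank of any invariant map. -/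
theorem IsUpperTrace.mul_finrank_le [Module.Finite k M] {ρ : Representation k (G p) M}
    {φ : Module.End k M} (h : IsUpperTrace ρ φ) {W : Type*} [AddCommGroup W] [Module k W]
    (Λ : M →ₗ[k] W) (hΛ : ∀ t x, Λ (ρ (upper t) x) = Λ x) :
    p * Module.finrank k (LinearMap.range Λ) ≤ Module.finrank k M := by
  have hp := (Fact.out : p.Prime).two_le
  let _ : AddCommGroup M := Module.addCommMonoidToAddCommGroup k
  set N : Module.End k M := ∑ t : ZMod p, ρ (upper t) with hN
  -- Applying the invariant `Λ` to the trace identity removes the outer group elements, so `Λ`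
  -- factors through the norm `N = (u - 1) ^ (p - 1)`.
  have h1 : Λ = (Λ ∘ₗ φ) ∘ₗ N := by
    ext x
    have hx := congrArg Λ (h x)
    rw [map_sum] at hx
    simp_rw [hΛ] at hx
    rw [← hx]
    simp only [hN, LinearMap.comp_apply, LinearMap.sum_apply, map_sum]
    exact Fintype.sum_equiv (Equiv.neg _) _ _ (fun t => rfl)
  have h2 : Module.finrank k (LinearMap.range Λ) ≤ Module.finrank k (LinearMap.range N) := by
    rw [h1, LinearMap.range_comp]
    exact Submodule.finrank_map_le _ _
  refine (Nat.mul_le_mul_left p h2).trans ?_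
  rw [hN, sum_upper_eq_pow]
  apply mul_finrank_range_le _ _ (by omega)
  have h3 : (Polynomial.X - 1 : Polynomial k) ^ p = Polynomial.X ^ p - 1 := by
    rw [sub_pow_char, one_pow]
  have h4 := congrArg (Polynomial.aeval (ρ (upper 1))) h3
  simp only [map_pow, map_sub, Polynomial.aeval_X, map_one] at h4
  rw [h4, ← map_pow]
  have h5 : ∀ j : ℕ, upper (p := p) (j : ZMod p) = upper 1 ^ j := by
    intro j
    induction j with
    | zero => simp [upper_zero]
    | succ j ih => rw [pow_succ, ← ih, ← upper_add, Nat.cast_succ]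
  rw [← h5, CharP.cast_eq_zero, upper_zero, map_one, sub_self]

omit [CharP k p] in
/-- The property of being projective over the upper unitriangular group passes to direct
summands. -/
theorem IsUpperTrace.of_retract {ρ : Representation k (G p) M} {φ : Module.End k M}
    (h : IsUpperTrace ρ φ) {M' : Type*} [AddCommMonoid M'] [Module k M']
    {σ : Representation k (G p) M'} (s : σ.IntertwiningMap ρ) (r : ρ.IntertwiningMap σ)
    (hrs : ∀ x, r (s x) = x) : IsUpperTrace σ (r.toLinearMap ∘ₗ φ ∘ₗ s.toLinearMap) := by
  intro x
  have := congrArg r (h (s x))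
  rw [map_sum, hrs] at this
  simp_rw [r.isIntertwining, ← s.isIntertwining] at this
  exact this

end UpperInvariants

section DirectSumMap

/-- A finite family of intertwining maps gives an intertwining map to the direct sum. -/
def toDirectSum {k G ι T : Type*} {M : ι → Type*} [Field k] [Monoid G] [Fintype ι] [DecidableEq ι]
    [∀ i, AddCommMonoid (M i)] [∀ i, Module k (M i)] [AddCommMonoid T] [Module k T]
    {ρ : ∀ i, Representation k G (M i)} {τ : Representation k G T}
    (f : ∀ i, τ.IntertwiningMap (ρ i)) : τ.IntertwiningMap (Representation.directSum ρ) where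
  toLinearMap := (DirectSum.linearEquivFunOnFintype k ι M).symm.toLinearMap ∘ₗ
    LinearMap.pi fun i => (f i).toLinearMap
  isIntertwining' g := by
    ext1 x
    apply DFinsupp.ext
    intro i
    exact (f i).isIntertwining _ _ g x

end DirectSumMap

/-! ### Functions on `𝔽_p²` and the moment map. -/

section Functions

variable (k : Type u) [Field k] (p : ℕ) [Fact p.Prime]

/-- The permutation representation on the functions on `𝔽_p²`. -/
def funRep : Representation k (G p) ((Fin 2 → ZMod p) → k) where
  toFun A := LinearMap.funLeft k k (fun v => Matrix.vecMul v A.1)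
  map_one' := by
    ext f v
    simp
  map_mul' A B := by
    ext f v
    simp [LinearMap.funLeft_apply, Matrix.vecMul_vecMul]

theorem funRep_apply (A : G p) (f : (Fin 2 → ZMod p) → k) (v : Fin 2 → ZMod p) :
    funRep k p A f v = f (Matrix.vecMul v A.1) := rfl

variable [CharP k p]

/-- A form as a function on `𝔽_p²`. -/
def toFunction (n : ℕ) : (V k p n).IntertwiningMap (funRep k p) :=
  LinearMap.intertwiningMap_of_isIntertwiningMap _ _
    (LinearMap.pi (fun v : Fin 2 → ZMod p =>
      (aeval (fun i => cst k p (v i)) : _ →ₐ[k] k).toLinearMap ∘ₗ Submodule.subtype _)) (by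
    intro A f
    ext v
    change eval _ (subst k p A f.1) = eval _ f.1
    rw [eval_subst, vecMul_cst])

theorem toFunction_apply (n : ℕ) (f : VSpace k n) (v : Fin 2 → ZMod p) :
    toFunction k p n f v = eval (fun i => cst k p (v i)) f.1 := rfl

/-- The linear form with zero `v`. -/
def linearForm (v : Fin 2 → ZMod p) : MvPolynomial (Fin 2) k :=
  cst k p (v 0) • X 1 - cst k p (v 1) • X 0

theorem linearForm_pow_mem (v : Fin 2 → ZMod p) (d : ℕ) :
    linearForm k p v ^ d ∈ homogeneousSubmodule (Fin 2) k d := by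
  have : linearForm k p v ∈ homogeneousSubmodule (Fin 2) k 1 :=
    sub_mem (Submodule.smul_mem _ _ (isHomogeneous_X k 1)) (Submodule.smul_mem _ _ (isHomogeneous_X k 0))
  simpa using IsHomogeneous.pow this d

theorem subst_linearForm (A : G p) (v : Fin 2 → ZMod p) :
    subst k p A (linearForm k p (Matrix.vecMul v A.1)) = linearForm k p v := by
  have hdet := congrArg (C : k → MvPolynomial (Fin 2) k) (entry_det (k := k) A)
  simp only [entry, map_sub, map_mul, map_one] at hdet
  simp only [linearForm, map_sub, Matrix.vecMul, dotProduct, Fin.sum_univ_two, map_add,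
    map_mul, subst, aeval_X, aeval_C, algebraMap_eq, Matrix.cons_val_zero, Matrix.cons_val_one,
    smul_eq_C_mul, entry]
  linear_combination (C (cst k p (v 0)) * X 1 - C (cst k p (v 1)) * X 0) * hdet

/-- The moment map from functions on `𝔽_p²` to forms. -/
def moment (n : ℕ) : (funRep k p).IntertwiningMap (V k p n) :=
  LinearMap.intertwiningMap_of_isIntertwiningMap _ _
    (∑ v : Fin 2 → ZMod p, (LinearMap.proj v).smulRight
      (⟨linearForm k p v ^ (n - 1), linearForm_pow_mem k p v _⟩ : VSpace k n)) (by
    intro A f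
    let E : (Fin 2 → ZMod p) ≃ (Fin 2 → ZMod p) :=
      { toFun := fun v => Matrix.vecMul v A.1
        invFun := fun v => Matrix.vecMul v (A⁻¹).1
        left_inv := fun v => by
          change Matrix.vecMul (Matrix.vecMul v A.1) (A⁻¹).1 = v
          rw [Matrix.vecMul_vecMul, ← Matrix.SpecialLinearGroup.coe_mul, mul_inv_cancel]
          simp
        right_inv := fun v => by
          change Matrix.vecMul (Matrix.vecMul v (A⁻¹).1) A.1 = v
          rw [Matrix.vecMul_vecMul, ← Matrix.SpecialLinearGroup.coe_mul, inv_mul_cancel]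
          simp }
    simp only [LinearMap.sum_apply, LinearMap.smulRight_apply, LinearMap.proj_apply, map_sum,
      map_smul]
    symm
    refine (E.sum_comp _).symm.trans (Finset.sum_congr rfl fun v _ => ?_)
    refine congrArg (f (Matrix.vecMul v A.1) • ·) (Subtype.ext ?_)
    change subst k p A (linearForm k p (Matrix.vecMul v A.1) ^ (n - 1)) = linearForm k p v ^ (n - 1)
    rw [map_pow, subst_linearForm])

theorem moment_coe (n : ℕ) (f : (Fin 2 → ZMod p) → k) :
    (moment k p n f : MvPolynomial (Fin 2) k) = ∑ v, f v • linearForm k p v ^ (n - 1) := by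
  change ((∑ v : Fin 2 → ZMod p, (LinearMap.proj v).smulRight
      (⟨linearForm k p v ^ (n - 1), linearForm_pow_mem k p v _⟩ : VSpace k n)) f).1 = _
  simp [LinearMap.sum_apply]

theorem sum_pow_mul_pow {a b : ℕ} (h : a + b < 2 * (p - 1)) :
    ∑ v : Fin 2 → ZMod p, cst k p (v 0) ^ a * cst k p (v 1) ^ b = 0 := by
  rw [← (finTwoArrowEquiv (ZMod p)).symm.sum_comp, Fintype.sum_prod_type]
  simp only [finTwoArrowEquiv_symm_apply, Matrix.cons_val_zero, Matrix.cons_val_one]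
  rw [← Finset.sum_mul_sum]
  rcases lt_or_ge a (p - 1) with ha | ha
  · rw [sum_cst_pow k p (by omega), if_neg (by omega), zero_mul]
  · rw [sum_cst_pow k p (e := b) (by omega), if_neg (by omega), mul_zero]

/-- Each coefficient is a sum over `𝔽_p²` of a monomial of degree `2(n - 1) < 2(p - 1)`, and one of
its exponents is then below `p - 1`. -/
theorem moment_toFunction {n : ℕ} (hn : n < p) (f : VSpace k n) :
    moment k p n (toFunction k p n f) = 0 := by
  have hp := (Fact.out : p.Prime).two_le
  apply Subtype.ext
  rw [moment_coe]
  simp only [toFunction_apply]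
  let F : MvPolynomial (Fin 2) k →ₗ[k] MvPolynomial (Fin 2) k :=
    ∑ v : Fin 2 → ZMod p, (aeval (fun i => cst k p (v i)) : _ →ₐ[k] k).toLinearMap.smulRight
      (linearForm k p v ^ (n - 1))
  have := eq_of_eq_mono F 0 (d := n - 1) ?_ f.2
  · simpa [F, LinearMap.sum_apply, aeval_eq_eval] using this
  intro l hl
  simp only [F, LinearMap.sum_apply, LinearMap.smulRight_apply, AlgHom.toLinearMap_apply,
    LinearMap.zero_apply, mono, map_mul, map_pow, aeval_X, linearForm, sub_eq_add_neg, add_pow,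
    Finset.smul_sum]
  rw [Finset.sum_comm]
  refine Finset.sum_eq_zero fun j hj => ?_
  rw [Finset.mem_range] at hj
  have h1 : ∀ v : Fin 2 → ZMod p, (cst k p (v 0) ^ (n - 1 - l) * cst k p (v 1) ^ l) •
      ((cst k p (v 0) • (X 1 : MvPolynomial (Fin 2) k)) ^ j *
        (-(cst k p (v 1) • X 0)) ^ (n - 1 - j) * ((n - 1).choose j : MvPolynomial (Fin 2) k)) =
      (cst k p (v 0) ^ (n - 1 - l + j) * cst k p (v 1) ^ (l + (n - 1 - j))) •
        (X 1 ^ j * (-X 0) ^ (n - 1 - j) * ((n - 1).choose j : MvPolynomial (Fin 2) k)) := by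
    intro v
    rw [← smul_neg, smul_pow, smul_pow]
    simp only [smul_eq_C_mul, map_mul, map_pow, pow_add]
    ring
  rw [Finset.sum_congr rfl fun v _ => h1 v, ← Finset.sum_smul, sum_pow_mul_pow k p (by omega),
    zero_smul]

/-- The pointwise product of forms, followed by the moment map. -/
def mulMoment (m : ℕ) : ((V k p p).tprod (V k p m)).IntertwiningMap (V k p p) :=
  (moment k p p).comp (LinearMap.intertwiningMap_of_isIntertwiningMap _ _
    (LinearMap.mul' k ((Fin 2 → ZMod p) → k) ∘ₗ
      TensorProduct.map (toFunction k p p).toLinearMap (toFunction k p m).toLinearMap) (by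
    intro A x
    induction x using TensorProduct.induction_on with
    | zero => simp
    | add x y hx hy => simp only [map_add, hx, hy]
    | tmul f g =>
      ext v
      simp only [Representation.tprod_apply, TensorProduct.map_tmul, LinearMap.comp_apply,
        LinearMap.mul'_apply, funRep_apply, Pi.mul_apply]
      change toFunction k p p (V k p p A f) v * toFunction k p m (V k p m A g) v = _
      rw [(toFunction k p p).isIntertwining, (toFunction k p m).isIntertwining]
      rfl))

theorem mulMoment_tmul (m : ℕ) (f : VSpace k p) (g : VSpace k m) :
    mulMoment k p m (f ⊗ₜ g) = moment k p p (toFunction k p p f * toFunction k p m g) := rfl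

end Functions

/-! ### Nonzero maps onto the simple modules. -/

section Simple

variable {k : Type u} [Field k] {p : ℕ} [CharP k p] [Fact p.Prime]

variable (k) in
/-- The highest weight vector `X ^ (n - 1)` of `V_n`. -/
def powX (n : ℕ) : VSpace k n := ⟨X 0 ^ (n - 1), by simpa [mono] using mono_mem k (n - 1) 0 (by omega)⟩

variable (k) in
/-- The lowest weight vector `Y ^ (n - 1)` of `V_n`. -/
def powY (n : ℕ) : VSpace k n :=
  ⟨X 1 ^ (n - 1), by simpa [mono] using mono_mem k (n - 1) (n - 1) le_rfl⟩

theorem powX_ne_zero (n : ℕ) : powX k n ≠ 0 := fun h =>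
  pow_ne_zero (n - 1) (X_ne_zero (R := k) (0 : Fin 2)) (congrArg Subtype.val h)

theorem isSimpleModule_V {n : ℕ} (hn : n ≤ p) : IsSimpleModule k[G p] (V k p n).asModule := by
  rw [isSimpleModule_iff]
  have : Nontrivial (V k p n).asModule :=
    ⟨⟨(V k p n).asModuleEquiv.symm (powX k n), 0, fun h => powX_ne_zero n h⟩⟩
  refine { exists_pair_ne := exists_pair_ne _, eq_bot_or_eq_top := fun W => ?_ }
  by_cases h0 : W = ⊥
  · exact Or.inl h0
  · right
    let W' : Submodule k (VSpace k n) := (W.restrictScalars k).map (V k p n).asModuleEquiv.toLinearMap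
    have hW' : ∀ x : (V k p n).asModule, (V k p n).asModuleEquiv x ∈ W' ↔ x ∈ W := by
      intro x
      constructor
      · rintro ⟨y, hy, hyx⟩
        rwa [← (V k p n).asModuleEquiv.injective hyx]
      · intro hx
        exact ⟨x, hx, rfl⟩
    have htop : W' = ⊤ := by
      apply V_simple hn
      · intro A f hf
        obtain ⟨x, rfl⟩ := (V k p n).asModuleEquiv.surjective f
        rw [hW'] at hf
        have := W.smul_mem (MonoidAlgebra.single A 1) hf
        rwa [← hW', Representation.asModuleEquiv_map_smul,
          Representation.asAlgebraHom_single_one] at this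
      · intro hbot
        apply h0
        rw [eq_bot_iff]
        intro x hx
        rw [← hW', hbot, Submodule.mem_bot] at hx
        exact (V k p n).asModuleEquiv.injective (hx.trans (map_zero _).symm)
    rw [eq_top_iff]
    intro x _
    rw [← hW', htop]
    exact Submodule.mem_top

theorem surjective_of_apply_ne_zero {n : ℕ} (hn : n ≤ p) {M : Type*} [AddCommMonoid M] [Module k M]
    {ρ : Representation k (G p) M} (f : ρ.IntertwiningMap (V k p n)) (x : M) (hx : f x ≠ 0) :
    Function.Surjective f := by
  have : LinearMap.range f.toLinearMap = ⊤ := by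
    apply V_simple hn
    · rintro A _ ⟨y, rfl⟩
      exact ⟨ρ A y, f.isIntertwining _ _ A y⟩
    · intro h
      exact hx ((Submodule.mem_bot k).1 (h ▸ ⟨x, rfl⟩))
  exact LinearMap.range_eq_top.1 this

/-- By Schur's lemma a nonzero map is bijective, and the dimensions tell the modules apart. -/
theorem eq_of_linearMap_ne_zero {i j : ℕ} (hi1 : 1 ≤ i) (hj1 : 1 ≤ j) (hi : i ≤ p) (hj : j ≤ p)
    (c : (V k p i).asModule →ₗ[k[G p]] (V k p j).asModule) (hc : c ≠ 0) : i = j := by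
  have := isSimpleModule_V (k := k) hi
  have := isSimpleModule_V (k := k) hj
  have hb : Function.Bijective c := by
    rcases LinearMap.bijective_or_eq_zero (R := k[G p]) (M := (V k p i).asModule)
      (N := (V k p j).asModule) c with h | h
    · exact h
    · exact absurd h hc
  have h1 := (LinearEquiv.ofBijective (c.restrictScalars k) hb).finrank_eq
  rw [(V k p i).asModuleEquiv.finrank_eq, (V k p j).asModuleEquiv.finrank_eq,
    finrank_VSpace k hi1, finrank_VSpace k hj1] at h1
  exact h1

theorem cayley_pow_X_pow {r : ℕ} (hr : 0 < r) (a b : ℕ) :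
    (cayley k ^ r) ((X 0 ^ a) ⊗ₜ (X 0 ^ b)) = 0 := by
  obtain ⟨s, rfl⟩ : ∃ s, r = s + 1 := ⟨r - 1, by omega⟩
  have : cayley k ((X 0 ^ a) ⊗ₜ (X 0 ^ b)) = 0 := by
    simp [cayley, dX, Derivation.leibniz_pow, pderiv_X]
  rw [pow_succ, Module.End.mul_apply, this, map_zero]

omit [Fact p.Prime] in
theorem transvectant_powX {n m i a b r : ℕ} (hn : n - 1 = a + r) (hm : m - 1 = b + r)
    (hi : i - 1 = a + b) (hr : 0 < r) :
    transvectant k p r hn hm hi (powX k n ⊗ₜ powX k m) = 0 := by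
  apply Subtype.ext
  rw [transvectant_coe, emb_tmul]
  exact (congrArg _ (cayley_pow_X_pow hr _ _)).trans (map_zero _)

theorem cayley_pow_X_pow_Y_pow (a b r : ℕ) :
    (cayley k ^ r) ((X 0 ^ (a + r)) ⊗ₜ (X 1 ^ (b + r))) =
      (((a + r).descFactorial r * (b + r).descFactorial r : ℕ) : k) • ((X 0 ^ a) ⊗ₜ (X 1 ^ b)) := by
  induction r generalizing a b with
  | zero => simp
  | succ r ih =>
    have h1 : cayley k ((X 0 ^ (a + (r + 1))) ⊗ₜ (X 1 ^ (b + (r + 1)))) =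
        (((a + (r + 1)) * (b + (r + 1)) : ℕ) : k) • ((X 0 ^ (a + r)) ⊗ₜ (X 1 ^ (b + r))) := by
      have h0 : ∀ (c : ℕ) (i : Fin 2), dX k i (X i ^ (c + 1)) = ((c + 1 : ℕ) : k) • X i ^ c := by
        intro c i
        simp [dX, Derivation.leibniz_pow, pderiv_X, Nat.cast_smul_eq_nsmul, add_smul]
      have h2 : ∀ c : ℕ, dX k 1 (X 0 ^ c) = 0 := by
        intro c
        simp [dX, Derivation.leibniz_pow, pderiv_X]
      rw [← add_assoc, ← add_assoc]
      simp only [cayley, LinearMap.sub_apply, TensorProduct.map_tmul, h0, h2,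
        TensorProduct.zero_tmul, sub_zero, TensorProduct.tmul_smul]
      rw [← TensorProduct.smul_tmul', smul_smul]
      push_cast
      congr 1
      ring
    rw [pow_succ, Module.End.mul_apply, h1, map_smul, ih, smul_smul]
    rw [← add_assoc, ← add_assoc, Nat.succ_descFactorial_succ, Nat.succ_descFactorial_succ]
    congr 1
    push_cast
    ring

theorem transvectant_ne_zero {n m i a b r : ℕ} (hn : n - 1 = a + r) (hm : m - 1 = b + r)
    (hi : i - 1 = a + b) (hnp : n - 1 < p) (hmp : m - 1 < p) :
    transvectant k p r hn hm hi (powX k n ⊗ₜ powY k m) ≠ 0 := by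
  intro h
  have h1 := congrArg Subtype.val h
  rw [transvectant_coe, emb_tmul] at h1
  change LinearMap.mul' k _ ((cayley k ^ r) ((X 0 ^ (n - 1)) ⊗ₜ (X 1 ^ (m - 1)))) = 0 at h1
  rw [hn, hm, cayley_pow_X_pow_Y_pow, map_smul, LinearMap.mul'_apply, Nat.cast_mul] at h1
  have hd : ∀ c : ℕ, c + r < p → ((c + r).descFactorial r : k) ≠ 0 := by
    intro c hc
    rw [Nat.descFactorial_eq_factorial_mul_choose, Nat.cast_mul]
    exact mul_ne_zero (factorial_ne_zero_of_lt k p (by omega))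
      (choose_ne_zero_of_lt k p (by omega) (by omega))
  rcases smul_eq_zero.1 h1 with h2 | h2
  · exact mul_ne_zero (hd a (by omega)) (hd b (by omega)) h2
  · exact mul_ne_zero (pow_ne_zero _ (X_ne_zero _)) (pow_ne_zero _ (X_ne_zero _)) h2

/-- Separates `mulMoment` from the transvectants of positive order, which kill this vector by
`transvectant_powX`. The coefficient of `X ^ (p - 1)` is, up to sign, the square of the sum of `t ^
(p - 1)`, hence `±1`. -/
theorem mulMoment_powX : mulMoment k p p (powX k p ⊗ₜ powX k p) ≠ 0 := by
  have hp := (Fact.out : p.Prime).two_le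
  intro h
  rw [mulMoment_tmul] at h
  have h1 := congrArg (fun f : VSpace k p => eval ![(1 : k), 0] f.1) h
  simp only [moment_coe, map_sum, smul_eval, map_pow] at h1
  have h2 : ∀ v : Fin 2 → ZMod p, (toFunction k p p (powX k p) * toFunction k p p (powX k p)) v *
      eval ![(1 : k), 0] (linearForm k p v) ^ (p - 1) =
      (-1) ^ (p - 1) * (cst k p (v 0) ^ (p - 1) * cst k p (v 1) ^ (p - 1)) := by
    intro v
    rw [Pi.mul_apply, toFunction_apply]
    have hi : cst k p (v 0) ^ (p - 1) * cst k p (v 0) ^ (p - 1) = cst k p (v 0) ^ (p - 1) := by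
      rw [← map_pow, ← map_mul]
      congr 1
      by_cases h0 : v 0 = 0
      · rw [h0, zero_pow (by omega), zero_mul]
      · rw [ZMod.pow_card_sub_one_eq_one h0, one_mul]
    have he : eval ![(1 : k), 0] (linearForm k p v) = -cst k p (v 1) := by
      simp [linearForm, smul_eval]
    have hX : eval (fun i => cst k p (v i)) (powX k p).1 = cst k p (v 0) ^ (p - 1) := by
      simp [powX]
    rw [he, hX, hi, neg_pow]
    ring
  rw [Finset.sum_congr rfl fun v _ => h2 v, ← Finset.mul_sum,
    ← (finTwoArrowEquiv (ZMod p)).symm.sum_comp, Fintype.sum_prod_type] at h1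
  simp only [finTwoArrowEquiv_symm_apply, Matrix.cons_val_zero, Matrix.cons_val_one] at h1
  rw [← Finset.sum_mul_sum, sum_cst_pow k p (by omega), if_pos rfl] at h1
  simp at h1

theorem moment_surjective {n : ℕ} (hn : n ≤ p) : Function.Surjective (moment k p n) := by
  classical
  apply surjective_of_apply_ne_zero hn _ (Pi.single ![1, 0] 1)
  intro h
  have h1 := congrArg Subtype.val h
  rw [moment_coe, Finset.sum_eq_single ![1, 0]] at h1
  · rw [Pi.single_eq_same, one_smul] at h1
    refine pow_ne_zero _ ?_ h1
    simp [linearForm, X_ne_zero]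
  · intro v _ hv
    rw [Pi.single_eq_of_ne hv, zero_smul]
  · simp

end Simple

/-! ### Lower bound for the dimension of `P_n`. -/

section Covers

variable {k : Type u} [Field k] {p : ℕ} [CharP k p] [Fact p.Prime]

variable (k p) in
/-- The module `P_n` is the module of the representation `P_n`. -/
def PEquiv (n : ℕ) : (P k p n).asModule ≃ₗ[k[G p]] PModule k p n where
  toFun x := RestrictScalars.addEquiv k k[G p] (PModule k p n) ((P k p n).asModuleEquiv x)
  invFun x := (P k p n).asModuleEquiv.symm ((RestrictScalars.addEquiv k k[G p] (PModule k p n)).symm x)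
  map_add' _ _ := rfl
  map_smul' r x := Representation.smul_ofModule_asModule (k := k) (G := G p) (PModule k p n) r x
  left_inv _ := rfl
  right_inv _ := rfl

/-- A module map to `P_n` as an intertwining map. -/
def intoP {M : Type*} [AddCommMonoid M] [Module k M] {ρ : Representation k (G p) M} {n : ℕ}
    (h : ρ.asModule →ₗ[k[G p]] PModule k p n) : ρ.IntertwiningMap (P k p n) :=
  (Representation.IntertwiningMap.equivLinearMapAsModule ρ (P k p n)).symm
    ((PEquiv k p n).symm.toLinearMap ∘ₗ h)

/-- A module map from `P_n` as an intertwining map. -/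
def fromP {M : Type*} [AddCommMonoid M] [Module k M] {ρ : Representation k (G p) M} {n : ℕ}
    (h : PModule k p n →ₗ[k[G p]] ρ.asModule) : (P k p n).IntertwiningMap ρ :=
  (Representation.IntertwiningMap.equivLinearMapAsModule (P k p n) ρ).symm
    (h ∘ₗ (PEquiv k p n).toLinearMap)

theorem finite_PSpace {n m : ℕ} {F : ((V k p p).tprod (V k p m)).asModule →ₗ[k[G p]] PModule k p n}
    (hF : Function.Surjective F) : Module.Finite k (PSpace k p n) :=
  Module.Finite.of_surjective (intoP F).toLinearMap hF

/-- Lower bound for the dimension of `P_n`. -/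
theorem le_finrank_PSpace {n m : ℕ} (h1 : 1 ≤ n) (hn : n ≤ p)
    {F : ((V k p p).tprod (V k p m)).asModule →ₗ[k[G p]] PModule k p n}
    (hF : Function.Surjective F) :
    2 * p ≤ Module.finrank k (PSpace k p n) + (if n = 1 then p else 0) + (if n = p then p else 0) := by
  have hp := (Fact.out : p.Prime).two_le
  obtain ⟨π, hπ⟩ := PModule_spec k p n
  have := hπ.projective
  have := finite_PSpace hF
  -- `P_n` is a direct summand of `V_p ⊗ V_m`, so it inherits the trace property.
  obtain ⟨s, hs⟩ := Module.projective_lifting_property F LinearMap.id hF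
  have htr := ((isUpperTrace_steinberg k p).tprod (V k p m)).of_retract (fromP s) (intoP F)
    (fun x => DFunLike.congr_fun hs x)
  have hupper : ∀ t, Matrix.vecMul (![0, 1] : Fin 2 → ZMod p) (upper t).1 = ![0, 1] := by
    intro t
    ext i
    fin_cases i <;> simp [upper, Matrix.vecMul, dotProduct, Fin.sum_univ_two]
  -- The point `(0, 1)` is fixed by the unitriangular group, so evaluation there turns any map to
  -- `funRep` into an invariant functional.
  let ev : ((Fin 2 → ZMod p) → k) →ₗ[k] k := LinearMap.proj ![0, 1]
  have hev : ∀ (f : (P k p n).IntertwiningMap (funRep k p)) t x,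
      ev (f (P k p n (upper t) x)) = ev (f x) := by
    intro f t x
    rw [f.isIntertwining]
    change f x (Matrix.vecMul ![0, 1] (upper t).1) = f x ![0, 1]
    rw [hupper]
  let a : (P k p n).IntertwiningMap (funRep k p) := (toFunction k p n).comp (fromP π)
  have hπs : Function.Surjective (fromP π) := hπ.surjective
  obtain ⟨y, hy⟩ : ∃ y, fromP π y = powY k n := hπs _
  have hay : ev (a y) = 1 := by
    change toFunction k p n (fromP π y) ![0, 1] = 1
    rw [hy, toFunction_apply]
    simp [powY]
  by_cases hmid : n ≠ 1 ∧ n ≠ p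
  · rw [if_neg hmid.1, if_neg hmid.2, add_zero, add_zero, mul_comm]
    let mom := Representation.IntertwiningMap.equivLinearMapAsModule _ _ (moment k p n)
    -- Two maps from `P_n` to the functions: `a` factors through the submodule of forms, whereas `b`
    -- lifts the quotient map `moment`.
    obtain ⟨b₀, hb₀⟩ := Module.projective_lifting_property mom π (moment_surjective hn)
    let b := fromP b₀
    have hb : ∀ x, moment k p n (b x) = fromP π x := fun x => DFunLike.congr_fun hb₀ x
    have hma : ∀ x, moment k p n (a x) = 0 := fun x => moment_toFunction k p (by omega) _
    have hdim := htr.mul_finrank_le ((ev ∘ₗ a.toLinearMap).prod (ev ∘ₗ b.toLinearMap)) (by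
      intro t x
      exact Prod.ext (hev a t x) (hev b t x))
    have hrange : LinearMap.range ((ev ∘ₗ a.toLinearMap).prod (ev ∘ₗ b.toLinearMap)) = ⊤ := by
      by_contra hne
      obtain ⟨g, hg0, hg⟩ := Submodule.exists_le_ker_of_lt_top _ (lt_top_iff_ne_top.2 hne)
      set c := g (1, 0) with hc
      set d := g (0, 1) with hd
      have hgcd : ∀ z, g z = c * z.1 + d * z.2 := by
        intro z
        have : z = z.1 • ((1 : k), (0 : k)) + z.2 • ((0 : k), (1 : k)) := by
          ext <;> simp
        conv_lhs => rw [this]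
        rw [map_add, map_smul, map_smul, smul_eq_mul, smul_eq_mul, mul_comm, mul_comm (z.2)]
      have hrel : ∀ x, c * a x ![0, 1] + d * b x ![0, 1] = 0 := by
        intro x
        have := hg ⟨x, rfl⟩
        rw [LinearMap.mem_ker, hgcd] at this
        exact this
      -- `G` is transitive on nonzero vectors, so a relation at `(0, 1)` holds at all of them.
      have hrel' : ∀ x v, v ≠ 0 → c * a x v + d * b x v = 0 := by
        intro x v hv
        obtain ⟨A, hA⟩ := exists_vecMul_eq v hv
        have := hrel (P k p n A x)
        rw [a.isIntertwining, b.isIntertwining, funRep_apply, funRep_apply, hA] at this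
        exact this
      have hd0 : d = 0 := by
        have h2 : moment k p n (c • a y + d • b y) = 0 := by
          apply Subtype.ext
          rw [moment_coe]
          refine Finset.sum_eq_zero fun v _ => ?_
          -- The origin, where nothing is known, does not contribute to the moment since `n ≠ 1`
          -- makes the exponent positive.
          by_cases hv : v = 0
          · have : linearForm k p v = 0 := by simp [hv, linearForm]
            rw [this, zero_pow (by omega), smul_zero]
          · have : (c • a y + d • b y) v = 0 := hrel' y v hv
            rw [this, zero_smul]
        rw [map_add, map_smul, map_smul, hma, smul_zero, zero_add, hb, hy] at h2
        refine (smul_eq_zero.1 h2).resolve_right fun h => ?_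
        exact pow_ne_zero (n - 1) (X_ne_zero (R := k) (1 : Fin 2)) (congrArg Subtype.val h)
      have hc0 : c = 0 := by
        have := hrel y
        rw [hd0, zero_mul, add_zero] at this
        change c * ev (a y) = 0 at this
        rwa [hay, mul_one] at this
      apply hg0
      refine LinearMap.ext fun z => ?_
      rw [hgcd, hc0, hd0]
      simp
    rw [hrange, finrank_top, Module.finrank_prod, Module.finrank_self] at hdim
    exact hdim
  · have hdim := htr.mul_finrank_le (ev ∘ₗ a.toLinearMap) (hev a)
    have hpos : 0 < Module.finrank k (LinearMap.range (ev ∘ₗ a.toLinearMap)) := by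
      rw [Module.finrank_pos_iff_exists_ne_zero]
      refine ⟨⟨1, y, hay⟩, fun h => one_ne_zero (congrArg Subtype.val h)⟩
    have h2 : p ≤ Module.finrank k (PSpace k p n) :=
      (Nat.le_mul_of_pos_right p hpos).trans hdim
    have h3 : n = 1 ∨ n = p := by tauto
    rcases h3 with h3 | h3
    · rw [if_pos h3]; omega
    · rw [if_pos h3]; omega

end Covers

/-! ### Decomposition of `V_p ⊗ V_m`. -/

section SteinbergTensor

variable {k : Type u} [Field k] {p : ℕ} [CharP k p] [Fact p.Prime]

/-- There are `⌈m / 2⌉` paired elements. A loss of `p` at `i = p` occurs only for odd `m`, where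
rounding up gains `p`; a loss at `i = 1` occurs only for `m = p`, where the extra `V_p` makes up for
it. -/
theorem sum_paired {m : ℕ} (hm : 1 ≤ m) (hmp : m ≤ p) {g : ℕ → ℕ}
    (hg : ∀ i ∈ paired p p m, 2 * p ≤ g i + (if i = 1 then p else 0) + (if i = p then p else 0)) :
    p * m ≤ ∑ i ∈ paired p p m, g i + (if m = p then p else 0) := by
  have hp := (Fact.out : p.Prime).two_le
  have hmem : ∀ i, i ∈ paired p p m ↔ ∃ r < p + m - p, i = p + m - 1 - 2 * r ∧ i ≤ p :=
    fun i => mem_paired hm hmp le_rfl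
  have hcard : (paired p p m).card = m - m / 2 := by
    have : paired p p m = (Finset.Ico (m / 2) m).image (fun r => p + m - 1 - 2 * r) := by
      ext i
      rw [hmem, Finset.mem_image]
      constructor
      · rintro ⟨r, h1, rfl, h2⟩
        exact ⟨r, Finset.mem_Ico.2 ⟨by omega, by omega⟩, rfl⟩
      · rintro ⟨r, hr, rfl⟩
        rw [Finset.mem_Ico] at hr
        exact ⟨r, by omega, rfl, by omega⟩
    rw [this, Finset.card_image_of_injOn, Nat.card_Ico]
    intro r hr s hs h
    simp only [Finset.coe_Ico, Set.mem_Ico] at hr hs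
    dsimp only at h
    omega
  have hone : 1 ∈ paired p p m → m = p := by
    rw [hmem]
    rintro ⟨r, h1, h2, -⟩
    omega
  have hmax : p ∈ paired p p m → m % 2 = 1 := by
    rw [hmem]
    rintro ⟨r, h1, h2, -⟩
    omega
  have hsum := Finset.sum_le_sum hg
  rw [Finset.sum_const, hcard, Finset.sum_add_distrib, Finset.sum_add_distrib,
    Finset.sum_ite_eq', Finset.sum_ite_eq', smul_eq_mul] at hsum
  have h1 : (if 1 ∈ paired p p m then p else 0) ≤ if m = p then p else 0 := by
    split_ifs with h h' <;> first | omega | exact absurd (hone h) h'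
  have h2 : p * m + (if p ∈ paired p p m then p else 0) ≤ (m - m / 2) * (2 * p) := by
    have h3 : (m - m / 2) * (2 * p) = p * (2 * (m - m / 2)) := by ring
    rw [h3]
    split_ifs with h
    · rw [← Nat.mul_succ]
      have := hmax h
      exact Nat.mul_le_mul_left p (by omega)
    · exact Nat.mul_le_mul_left p (by omega)
  omega

theorem module_free_of_field (M : Type*) [AddCommMonoid M] [Module k M] : Module.Free k M :=
  let _ : AddCommGroup M := Module.addCommMonoidToAddCommGroup k
  Module.Free.of_divisionRing k M

theorem injective_of_surjective_of_finrank_le {M N : Type*} [AddCommMonoid M] [Module k M]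
    [AddCommMonoid N] [Module k N] [Module.Finite k M] (f : M →ₗ[k] N) (hf : Function.Surjective f)
    (h : Module.finrank k M ≤ Module.finrank k N) : Function.Injective f := by
  let _ : AddCommGroup M := Module.addCommMonoidToAddCommGroup k
  let _ : AddCommGroup N := Module.addCommMonoidToAddCommGroup k
  have := Module.Finite.of_surjective f hf
  exact (LinearMap.injective_iff_surjective_of_finrank_eq_finrank
    (h.antisymm (LinearMap.finrank_le_finrank_of_surjective hf))).2 hf

/-- For `m = p` the condition `i ≤ p` forces the order `r` to be positive, which gives the
vanishing. -/
theorem exists_transvectant {m i : ℕ} (hm : 1 ≤ m) (hmp : m ≤ p) (hi : i ∈ paired p p m) :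
    ∃ T : ((V k p p).tprod (V k p m)).IntertwiningMap (V k p i),
      (∃ x, T x ≠ 0) ∧ (m = p → T (powX k p ⊗ₜ powX k m) = 0) := by
  have hp := (Fact.out : p.Prime).two_le
  obtain ⟨r, hr, hir, hip⟩ := (mem_paired hm hmp le_rfl).1 hi
  have h1 : p - 1 = (p - 1 - r) + r := by omega
  have h2 : m - 1 = (m - 1 - r) + r := by omega
  have h3 : i - 1 = (p - 1 - r) + (m - 1 - r) := by omega
  exact ⟨transvectant k p r h1 h2 h3,
    ⟨_, transvectant_ne_zero h1 h2 h3 (by omega) (by omega)⟩,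
    fun h => transvectant_powX h1 h2 h3 (by omega)⟩

/-- The decomposition of the projective module `V_p ⊗ V_m`. -/
theorem exists_equiv_paired_prod {m : ℕ} (hm : 1 ≤ m) (hmp : m ≤ p) :
    Nonempty (((V k p p).tprod (V k p m)).Equiv
      ((Representation.directSum fun i : paired p p m => P k p (i : ℕ)).prod
        (Representation.directSum fun _ : Fin (if m = p then 1 else 0) => V k p p))) := by
  classical
  have hp := (Fact.out : p.Prime).two_le
  have hpos : ∀ i ∈ paired p p m, 1 ≤ i ∧ i ≤ p := by
    intro i hi
    obtain ⟨r, hr, hir, hip⟩ := (mem_paired hm hmp le_rfl).1 hi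
    omega
  have he : ∀ _ : Fin (if m = p then 1 else 0), m = p := by
    intro j
    by_contra h
    rw [if_neg h] at j
    exact j.elim0
  have : Subsingleton (Fin (if m = p then 1 else 0)) := by
    split_ifs <;> infer_instance
  choose T hT0 hTX using fun i : paired p p m => exists_transvectant (k := k) hm hmp i.2
  let d : (paired p p m) ⊕ Fin (if m = p then 1 else 0) → ℕ := Sum.elim (fun i => i) (fun _ => p)
  have hd : ∀ a, 1 ≤ d a ∧ d a ≤ p := by
    rintro (i | j)
    · exact hpos i i.2
    · exact ⟨by change 1 ≤ p; omega, le_rfl⟩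
  let f : ∀ a, ((V k p p).tprod (V k p m)).asModule →ₗ[k[G p]] (V k p (d a)).asModule := fun a =>
    match a with
    | Sum.inl i => Representation.IntertwiningMap.equivLinearMapAsModule _ _ (T i)
    | Sum.inr _ => Representation.IntertwiningMap.equivLinearMapAsModule _ _ (mulMoment k p m)
  have hsimple : ∀ a, IsSimpleModule k[G p] (V k p (d a)).asModule := fun a =>
    isSimpleModule_V (hd a).2
  have hf : Function.Surjective (LinearMap.pi f) := by
    refine surjective_pi_of_isSimpleModule (R := k[G p]) (Q := ((V k p p).tprod (V k p m)).asModule)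
      (S := fun a => (V k p (d a)).asModule) f ?_
    intro j c hc
    let z : ((V k p p).tprod (V k p m)).asModule :=
      ((V k p p).tprod (V k p m)).asModuleEquiv.symm (powX k p ⊗ₜ powX k m)
    -- For odd `p = m` the module `V_p` also occurs among the paired ones, so dimensions do not
    -- separate the extra copy; evaluating the relation at `z` does.
    have hinr : ∀ b, c (Sum.inr b) = 0 := by
      intro b
      have hmp' := he b
      have h1 := DFunLike.congr_fun hc z
      rw [LinearMap.sum_apply, Fintype.sum_sum_type, Fintype.sum_subsingleton _ b,
        Finset.sum_eq_zero, zero_add] at h1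
      · refine (LinearMap.injective_or_eq_zero (R := k[G p])
          (M := (V k p (d (Sum.inr b))).asModule) (N := (V k p (d j)).asModule) (c (Sum.inr b))).resolve_left
          fun h => ?_
        have h2 : f (Sum.inr b) z = 0 := h (h1.trans (map_zero _).symm)
        have h3 : mulMoment k p m (powX k p ⊗ₜ powX k m) = 0 := h2
        subst hmp'
        exact mulMoment_powX h3
      · intro i _
        have : f (Sum.inl i) z = 0 := hTX i hmp'
        rw [LinearMap.comp_apply, this, map_zero]
    have hinl : ∀ i, c (Sum.inl i) = 0 := by
      intro i
      by_contra hci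
      have hij := eq_of_linearMap_ne_zero (hd (Sum.inl i)).1 (hd j).1 (hd (Sum.inl i)).2 (hd j).2
        (c (Sum.inl i)) hci
      have hother : ∀ i', i' ≠ i → c (Sum.inl i') = 0 := by
        intro i' hne
        by_contra hci'
        have hij' := eq_of_linearMap_ne_zero (hd (Sum.inl i')).1 (hd j).1 (hd (Sum.inl i')).2
          (hd j).2 (c (Sum.inl i')) hci'
        exact hne (Subtype.ext (hij'.trans hij.symm))
      rw [Fintype.sum_sum_type, Finset.sum_eq_single i
        (fun i' _ hne => by rw [hother i' hne, LinearMap.zero_comp]) (by simp),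
        Finset.sum_eq_zero (fun b _ => by rw [hinr b, LinearMap.zero_comp]), add_zero] at hc
      apply hci
      obtain ⟨x, hx⟩ := hT0 i
      have hs := surjective_of_apply_ne_zero (hpos i i.2).2 (T i) x hx
      refine LinearMap.ext fun y => ?_
      obtain ⟨w, hw⟩ := hs ((V k p i).asModuleEquiv y)
      have := DFunLike.congr_fun hc (((V k p p).tprod (V k p m)).asModuleEquiv.symm w)
      have hy : f (Sum.inl i) (((V k p p).tprod (V k p m)).asModuleEquiv.symm w) = y := hw
      rw [LinearMap.comp_apply, hy] at this
      exact this
    rintro (i | b)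
    · exact hinl i
    · exact hinr b
  choose π hπ using fun a => PModule_spec k p (d a)
  have := projective_steinberg_tprod k p m
  obtain ⟨F, hF⟩ := exists_surjective_pi_cover (R := k[G p])
    (Q := ((V k p p).tprod (V k p m)).asModule) (S := fun a => (V k p (d a)).asModule) π hπ f hf
  let Φ₁ : ((V k p p).tprod (V k p m)).IntertwiningMap
      (Representation.directSum fun i : paired p p m => P k p (i : ℕ)) :=
    toDirectSum fun i => intoP (F (Sum.inl i))
  let Φ₂ : ((V k p p).tprod (V k p m)).IntertwiningMap
      (Representation.directSum fun _ : Fin (if m = p then 1 else 0) => V k p p) :=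
    -- For the extra summand the lift to the cover is pushed down to `V_p`, whose dimension `p` is
    -- all that the count needs.
    toDirectSum fun j => (fromP (ρ := V k p p) (π (Sum.inr j))).comp (intoP (F (Sum.inr j)))
  let Φ := Φ₁.prod Φ₂
  have hΦ : Function.Surjective Φ := by
    rintro ⟨x, y⟩
    choose y' hy' using fun j => (hπ (Sum.inr j)).surjective ((V k p p).asModuleEquiv.symm (y j))
    obtain ⟨q, hq⟩ := hF (fun a => match a with
      | Sum.inl i => RestrictScalars.addEquiv k k[G p] _ (x i)
      | Sum.inr j => y' j)
    refine ⟨((V k p p).tprod (V k p m)).asModuleEquiv q, Prod.ext ?_ ?_⟩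
    · refine DFinsupp.ext fun i => ?_
      exact congrFun hq (Sum.inl i)
    · refine DFinsupp.ext fun j => ?_
      have h1 : F (Sum.inr j) q = y' j := congrFun hq (Sum.inr j)
      exact (congrArg (π (Sum.inr j)) h1).trans (hy' j)
  have hFs : ∀ a, Function.Surjective (F a) := fun a y => by
    obtain ⟨q, hq⟩ := hF (Pi.single a y)
    exact ⟨q, (congrFun hq a).trans (Pi.single_eq_same (M := fun a => PModule k p (d a)) a y)⟩
  have hfin : ∀ i : paired p p m, Module.Finite k (PSpace k p i) := fun i =>
    finite_PSpace (hFs (Sum.inl i))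
  have hfree : ∀ i : paired p p m, Module.Free k (PSpace k p i) := fun i =>
    module_free_of_field _
  have hdim : Module.finrank k (VSpace k p ⊗[k] VSpace k m) ≤ Module.finrank k
      (DirectSum (paired p p m) (fun i => PSpace k p i) ×
        DirectSum (Fin (if m = p then 1 else 0)) (fun _ => VSpace k p)) := by
    rw [Module.finrank_prod, Module.finrank_directSum, Module.finrank_directSum,
      Module.finrank_tensorProduct, finrank_VSpace k (by omega), finrank_VSpace k hm,
      Finset.sum_coe_sort (paired p p m) (fun i => Module.finrank k (PSpace k p i))]
    have := sum_paired (p := p) hm hmp (g := fun i => Module.finrank k (PSpace k p i))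
      fun i hi => le_finrank_PSpace (hpos i hi).1 (hpos i hi).2 (hFs (Sum.inl ⟨i, hi⟩))
    simpa using this
  exact ⟨Representation.IntertwiningMap.ofBijective Φ
    ⟨injective_of_surjective_of_finrank_le Φ.toLinearMap hΦ hdim, hΦ⟩⟩

end SteinbergTensor

/-! ### Assembly of the decomposition. -/

section Assembly

variable {k G : Type*} [Field k] [Monoid G]

/-- A decomposition of the second summand refines a decomposition. -/
theorem nonempty_equiv_prod_prod {T U Q A B : Type*} [AddCommMonoid T] [Module k T]
    [AddCommMonoid U] [Module k U] [AddCommMonoid Q] [Module k Q] [AddCommMonoid A] [Module k A]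
    [AddCommMonoid B] [Module k B] {τ : Representation k G T} {υ : Representation k G U}
    {κ : Representation k G Q} {α : Representation k G A} {β : Representation k G B}
    (e : τ.Equiv (υ.prod κ)) (e' : κ.Equiv (α.prod β)) :
    Nonempty (τ.Equiv ((υ.prod α).prod β)) := by
  let Φ : (υ.prod κ).IntertwiningMap ((υ.prod α).prod β) :=
    ((Representation.IntertwiningMap.fst k (ρ := υ) (σ := κ)).prod
      (((Representation.IntertwiningMap.fst k (ρ := α) (σ := β)).comp e'.toIntertwiningMap).comp
        (Representation.IntertwiningMap.snd k (ρ := υ) (σ := κ)))).prod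
      (((Representation.IntertwiningMap.snd k (ρ := α) (σ := β)).comp e'.toIntertwiningMap).comp
        (Representation.IntertwiningMap.snd k (ρ := υ) (σ := κ)))
  refine ⟨e.trans (Representation.IntertwiningMap.ofBijective Φ ⟨?_, ?_⟩)⟩
  · rintro ⟨u, q⟩ ⟨u', q'⟩ h
    have h1 : ((u, (e' q).1), (e' q).2) = ((u', (e' q').1), (e' q').2) := h
    simp only [Prod.mk.injEq] at h1
    exact Prod.ext h1.1.1 (e'.toLinearEquiv.injective (Prod.ext h1.1.2 h1.2))
  · rintro ⟨⟨u, a⟩, b⟩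
    obtain ⟨q, hq⟩ := e'.toLinearEquiv.surjective (a, b)
    have hq' : e' q = (a, b) := hq
    refine ⟨(u, q), ?_⟩
    change ((u, (e' q).1), (e' q).2) = _
    rw [hq']

end Assembly

section Main

/-- The decomposition of `V_n ⊗ V_m` for `m ≤ n ≤ p`. -/
theorem nonempty_equiv_tprod {k : Type*} [Field k] (p : ℕ) [Fact p.Prime] [CharP k p]
    (n m : ℕ) (hm : 1 ≤ m) (hmn : m ≤ n) (hnp : n ≤ p) :
    Nonempty (((V k p n).tprod (V k p m)).Equiv
      (((Representation.directSum fun i : unpaired p n m => V k p (i : ℕ)).prod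
        (Representation.directSum fun i : paired p n m => P k p (i : ℕ))).prod
        (Representation.directSum fun _ : Fin (if n = m ∧ m = p then 1 else 0) =>
          V k p p))) := by
  have hp := (Fact.out : p.Prime).two_le
  rcases le_or_gt (n + m) p with h | h
  · rw [paired_eq_empty hm hmn hnp h,
      if_neg (show ¬(n = m ∧ m = p) by omega)]
    -- Here `n + m - p` is `0`: the unpaired summands fill the tensor product and the complement is
    -- the zero module.
    obtain ⟨e⟩ := exists_equiv_unpaired_prod (k := k) hm hmn hnp
      (Representation.trivial k (G p) PUnit.{1}) 0 (Function.injective_of_subsingleton _)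
      (fun _ _ _ _ _ _ _ _ _ => map_zero _) (by
        rw [Nat.sub_eq_zero_of_le h, Module.finrank_zero_of_subsingleton]
        simp [mul_comm])
    refine nonempty_equiv_prod_prod e (Representation.IntertwiningMap.ofBijective 0
      ⟨Function.injective_of_subsingleton _, fun x => ⟨PUnit.unit, Subsingleton.elim _ _⟩⟩)
  · have hl : (if n = m ∧ m = p then 1 else 0) = if n + m - p = p then 1 else 0 := by
      split_ifs <;> omega
    rw [hl, paired_eq hm hmn hnp h]
    -- Degree `p - n` is moved from the first factor of `V_p ⊗ V_(n + m - p)` to the second.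
    have hq : p - 1 = n - 1 + (p - n) := by omega
    have hl : m - 1 = n + m - p - 1 + (p - n) := by omega
    obtain ⟨e'⟩ := exists_equiv_paired_prod (k := k) (p := p) (m := n + m - p) (by omega) (by omega)
    obtain ⟨e⟩ := exists_equiv_unpaired_prod (k := k) hm hmn hnp
      (N := TensorProduct k (VSpace k p) (VSpace k (n + m - p))) _
      (polarization k p (p - n) hq hl)
      (polarization_injective _ hq hl (by omega) (by omega))
      (fun _ _ _ _ ha hb hi hr x => transvectant_polarization _ hq hl ha hb hi (by omega) x) (by
        rw [Module.finrank_tensorProduct, finrank_VSpace k (by omega), finrank_VSpace k (by omega)]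
        obtain ⟨c, rfl⟩ : ∃ c, p = n + c := ⟨p - n, by omega⟩
        obtain ⟨l, rfl⟩ : ∃ l, m = l + c := ⟨m - c, by omega⟩
        obtain ⟨s, rfl⟩ : ∃ s, n = l + s := ⟨n - l, by omega⟩
        rw [show l + s + (l + c) - (l + s + c) = l by omega, Nat.add_sub_cancel_left,
          Nat.add_sub_cancel_left]
        ring)
    exact nonempty_equiv_prod_prod e e'

end Main

end SL2Fp

end

theorem theorem3p4 {k : Type*} [Field k] [IsAlgClosed k] (p : ℕ) [Fact p.Prime] [CharP k p]
    (n m : ℕ) (hm : 1 ≤ m) (hmn : m ≤ n) (hnp : n ≤ p) :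
    Nonempty (((SL2Fp.V k p n).tprod (SL2Fp.V k p m)).Equiv
      (((Representation.directSum fun i : SL2Fp.unpaired p n m => SL2Fp.V k p (i : ℕ)).prod
        (Representation.directSum fun i : SL2Fp.paired p n m => SL2Fp.P k p (i : ℕ))).prod
        (Representation.directSum fun _ : Fin (if n = m ∧ m = p then 1 else 0) =>
          SL2Fp.V k p p))) :=
  SL2Fp.nonempty_equiv_tprod p n m hm hmn hnp
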